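/- Let $\mathbb{K}$ be an algebraically closed field of characteristic zero, let $M$ be a lattice (a free abelian group of finite rank), let $\mathcal{A}\subset M$ be a finite set, and let $\tau$ be a face of $\mathcal{A}$, i.e. the intersection of $\mathcal{A}$ with a face of $\operatorname{conv}\mathcal{A}\subset M\otimes\mathbb{R}$. Notation. Let $X_\tau\subseteq X_{\mathcal{A}}\subseteq\mathbb{P}^{\#\mathcal{A}-1}$ be the projective toric variety (with homogeneous coordinates $x_u$, $u\in\mathcal{A}$) whose ideal is the kernel of the homomorphism $\mathbb{K}[x_u : u\in\mathcal{A}]\to\mathbb{K}[M\times\mathbb{Z}]$ sending $x_u$ to the monomial $\chi^{(u,1)}$ if $u\in\tau$ and to $0$ otherwise. Let $\langle\tau\rangle\subseteq M$ be the sublattice generated by all differences of elements of $\tau$. The torus $T_\tau=\operatorname{Spec}\mathbb{K}[\langle\tau\rangle]$, with $\mathbb{K}$-points $\operatorname{Hom}(\langle\tau\rangle,\mathbb{K}^*)$, acts on $X_\tau$ with weight $u$ on the coordinate $x_u$; explicitly, for any fixed $w\in\tau$, $t\cdot(x_u)_{u\in\tau}=(t(u-w)\,x_u)_{u\in\tau}$.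 The dense orbit of $X_\tau$ is the $T_\tau$-orbit of the point with $x_u=1$ for $u\in\tau$ and $x_u=0$ for $u\notin\tau$. For $\ell,d\in\mathbb{N}$ let $\Delta_\ell(d)=\{v\in\mathbb{Z}_{\ge0}^{\ell+1} : v_0+\dots+v_\ell=d\}$. A Cayley structure of length $\ell$ and degree $d$ on $\tau$ is a non-constant map $\pi:\tau\to\Delta_\ell(d)$ that is affine-linear (there is a homomorphism $L:\langle\tau\rangle\to\mathbb{Z}^{\ell+1}$ with $\pi(u)-\pi(w)=L(u-w)$ for all $u,w\in\tau$), basepoint-free (for every $i\in\{0,\dots,\ell\}$ there is $u\in\tau$ with $\pi(u)_i=0$) and concise (for every $i$ there is $u\in\tau$ with $\pi(u)_i\neq0$). For a tuple $\mathbf{f}=(f_0,\dots,f_\ell)$ of linear forms in $\mathbb{K}[y_0,y_1]$, let $C_{\pi,\mathbf{f}}\subseteq X_\tau$ be the closure of the image of the rational map $\mathbb{P}^1\dashrightarrow X_\tau$ given by $x_u=\prod_i f_i^{\pi(u)_i}$ for $u\in\tau$ and $x_u=0$ for $u\in\mathcal{A}\setminus\tau$. Let $M_{0,\ell+1}$ be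 the set of $(\ell+1)$-tuples of distinct points $(P_0,\dots,P_\ell)$ of $\mathbb{P}^1$ modulo automorphisms of $\mathbb{P}^1$ (a single point if $\ell\le1$). Each $\mathbf{p}\in M_{0,\ell+1}$ is represented by a tuple with $P_0=(1:0)$ and $P_i=(c_i:1)$ for $i>0$, where $c_1=0$ and $c_2=1$ (as far as these indices occur), and we put $\mathbf{f}(\mathbf{p})=(y_1,\,y_0-c_1y_1,\,\dots,\,y_0-c_\ell y_1)$, that is, $(y_1,\,y_0,\,y_0-y_1,\,y_0-c_3y_1,\,\dots)$. Proposition. Let $C\subseteq X_\tau$ be a rational curve (a closed irreducible one-dimensional subvariety of $\mathbb{P}^{\#\mathcal{A}-1}$, birational to $\mathbb{P}^1$) of degree $d$ that meets the dense orbit of $X_\tau$. (1) There exist $\ell\in\mathbb{N}$, a Cayley structure $\pi:\tau\to\Delta_\ell(d)$, a point $\mathbf{p}\in M_{0,\ell+1}$ and $t\in T_\tau$ such that $C=t\cdot C_{\pi,\mathbf{f}(\mathbf{p})}$. (2) The pair $(\pi,\mathbf{p})$ is unique up to $S_{\ell+1}$: if $(\ell,\pi,\mathbf{p},t)$ and $(\ell',\pi',\mathbf{p}',t')$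 are both as in (1), then $\ell=\ell'$ and there is a permutation $\sigma$ of $\{0,\dots,\ell\}$ such that $\pi'(u)_{\sigma(i)}=\pi(u)_i$ for all $u\in\tau$ and all $i$, and such that $\mathbf{p}'$ is obtained from $\mathbf{p}$ by giving the point with label $i$ the label $\sigma(i)$. (3) If $(\ell,\pi,\mathbf{p},t)$ is as in (1) and $\ell>1$, then there are only finitely many $g\in T_\tau$ with $g\cdot C=C$. -/

import Mathlib

open scoped LinearAlgebra.Projectivization TensorProduct

noncomputable section

namespace ToricCurves

/-! ### Classical projective varieties over a field, as sets of points -/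

section Projective

variable {K : Type*} [Field K] {σ : Type*}

/-- The homogeneous vanishing ideal `I(S)` of a set of points of projective space: the polynomials
that vanish at every vector of homogeneous coordinates of every point of `S`. -/
def projIdeal (S : Set (ℙ K (σ → K))) : Ideal (MvPolynomial σ K) :=
  MvPolynomial.vanishingIdeal K {v : σ → K | ∃ hv : v ≠ 0, Projectivization.mk K v hv ∈ S}

/-- The closed subset of projective space defined by a (homogeneous) ideal. -/
def projZeros (I : Ideal (MvPolynomial σ K)) : Set (ℙ K (σ → K)) :=
  {x | ∀ (v : σ → K) (hv : v ≠ 0),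
    Projectivization.mk K v hv = x → v ∈ MvPolynomial.zeroLocus K I}

/-- The Zariski closure of a set of points of projective space. -/
def projClosure (S : Set (ℙ K (σ → K))) : Set (ℙ K (σ → K)) :=
  projZeros (projIdeal S)

/-- `C` is an (irreducible, closed) projective variety. -/
def IsProjVariety (C : Set (ℙ K (σ → K))) : Prop :=
  projClosure C = C ∧ (projIdeal C).IsPrime

/-- The Hilbert function of the homogeneous coordinate ring `K[x] / I(C)`: the dimension of the
image of the space of forms of degree `m`. -/
def hilbertFunction (C : Set (ℙ K (σ → K))) (m : ℕ) : ℕ :=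
  Module.finrank K
    ((MvPolynomial.homogeneousSubmodule σ K m).map
      (Ideal.Quotient.mkₐ K (projIdeal C)).toLinearMap)

/-- `P` is the Hilbert polynomial of `C`. -/
def IsHilbertPolynomial (C : Set (ℙ K (σ → K))) (P : Polynomial ℚ) : Prop :=
  ∀ᶠ m : ℕ in Filter.atTop, (hilbertFunction C m : ℚ) = P.eval (m : ℚ)

/-- `C` has dimension one and degree `d`: its Hilbert polynomial has degree `1` and leading
coefficient `d`. -/
def IsOneDimensionalOfDegree (C : Set (ℙ K (σ → K))) (d : ℕ) : Prop :=
  ∃ P : Polynomial ℚ, IsHilbertPolynomial C P ∧ P.natDegree = 1 ∧ P.leadingCoeff = d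

/-- The variety `C` is birational to the projective line: there are a rational map from the line
to `C`, given by forms `F` of a common degree in two variables, and a rational map from `C` to the
line, given by two forms `G` of a common degree, such that both composites are defined and equal
to the identity as rational maps. -/
def IsBirationalToLine (C : Set (ℙ K (σ → K))) : Prop :=
  ∃ (a b : ℕ) (F : σ → MvPolynomial (Fin 2) K) (G : Fin 2 → MvPolynomial σ K),
    (∀ u, (F u).IsHomogeneous a) ∧ (∀ j, (G j).IsHomogeneous b) ∧
    -- `F` maps the line to `C`
    (∀ q ∈ projIdeal C, MvPolynomial.bind₁ F q = 0) ∧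
    -- `G ∘ F` is the identity of the line
    (∃ H : MvPolynomial (Fin 2) K, H ≠ 0 ∧
      ∀ j, MvPolynomial.bind₁ F (G j) = H * MvPolynomial.X j) ∧
    -- `F ∘ G` is the identity of `C`
    (∃ h : MvPolynomial σ K, h ∉ projIdeal C ∧
      ∀ u, MvPolynomial.bind₁ G (F u) - h * MvPolynomial.X u ∈ projIdeal C)

/-- `C` is a rational curve of degree `d` in projective space. -/
structure IsRationalCurve (C : Set (ℙ K (σ → K))) (d : ℕ) : Prop where
  isProjVariety : IsProjVariety C
  isOneDimensionalOfDegree : IsOneDimensionalOfDegree C d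
  isBirationalToLine : IsBirationalToLine C

end Projective

/-! ### Projective toric varieties -/

section Toric

variable {M : Type*} [AddCommGroup M]

/-- `τ` is a face of the finite set `A` of lattice points: the intersection of `A` with a face of
the convex hull of `A` in the real vector space `ℝ ⊗ M`. -/
def IsFace (τ A : Finset M) : Prop :=
  ∃ F : Set (ℝ ⊗[ℤ] M),
    IsExtreme ℝ (convexHull ℝ ((fun u : M => (1 : ℝ) ⊗ₜ[ℤ] u) '' (A : Set M))) F ∧
    Convex ℝ F ∧ ∀ u : M, u ∈ τ ↔ u ∈ A ∧ (1 : ℝ) ⊗ₜ[ℤ] u ∈ F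

/-- The lattice `⟨τ⟩` of differences of elements of `τ`. -/
def diffLattice (τ : Finset M) : AddSubgroup M :=
  AddSubgroup.closure {m | ∃ u ∈ τ, ∃ w ∈ τ, m = u - w}

/-- The difference of two elements of `τ`, as an element of `⟨τ⟩`. -/
def diff {τ : Finset M} (u w : τ) : diffLattice τ :=
  ⟨(u : M) - w, AddSubgroup.subset_closure ⟨u, u.2, w, w.2, rfl⟩⟩

variable (K : Type*) [Field K]

/-- The torus `T_τ = Spec K[⟨τ⟩]`, through its group of `K`-points. -/
abbrev Torus (τ : Finset M) : Type _ := Multiplicative (diffLattice τ) →* Kˣ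

open Classical in
/-- The kernel of the composite `K[x_u : u ∈ A] → K[S_A] → K[S_τ] ⊆ K[M × ℤ]`, which sends `x_u` to
the monomial with exponent `(u, 1)` if `u ∈ τ` and to `0` otherwise. -/
def toricIdeal (A τ : Finset M) : Ideal (MvPolynomial A K) :=
  RingHom.ker (MvPolynomial.aeval (R := K) (fun u : A =>
    if (u : M) ∈ τ then (AddMonoidAlgebra.single ((u : M), (1 : ℤ)) 1 : AddMonoidAlgebra K (M × ℤ))
    else 0))

/-- The toric variety `X_τ`, embedded in `X_A` and hence in the projective space with one
homogeneous coordinate for each element of `A`. -/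
def toricVariety (A τ : Finset M) : Set (ℙ K (A → K)) :=
  projZeros (toricIdeal K A τ)

variable {K}

open Classical in
/-- The scalars by which `t ∈ T_τ` acts on the homogeneous coordinates `x_u`, `u ∈ τ`, after all
weights have been translated by `-w`, where `w ∈ τ`; another choice of `w` multiplies all
these scalars by a common factor. The coordinates that vanish on `X_τ` are left alone. -/
def torusScalars (A : Finset M) {τ : Finset M} (t : Torus K τ) (w : τ) : A → Kˣ :=
  fun u => if h : (u : M) ∈ τ then t (Multiplicative.ofAdd (diff ⟨u, h⟩ w)) else 1

/-- The automorphism of projective space that multiplies the homogeneous coordinate `x_u` by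
`c u`. -/
def rescale {ι : Type*} (c : ι → Kˣ) : ℙ K (ι → K) → ℙ K (ι → K) :=
  Projectivization.map
    (LinearEquiv.piCongrRight fun u => DistribMulAction.toLinearEquiv K K (c u)).toLinearMap
    (LinearEquiv.injective _)

/-- The translate `t · C` of a set `C` of points of `X_τ` by `t ∈ T_τ` (on points of `X_τ` the
action does not depend on `w`). -/
def translate {A τ : Finset M} (t : Torus K τ) (C : Set (ℙ K (A → K))) : Set (ℙ K (A → K)) :=
  {y | ∃ x ∈ C, ∃ w : τ, y = rescale (torusScalars A t w) x}

open Classical in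
/-- The dense torus orbit of `X_τ`: the `T_τ`-orbit of the point `x_τ`, whose coordinates are `1`
for `u ∈ τ` and `0` for `u ∉ τ`. -/
def denseOrbit (K : Type*) [Field K] (A τ : Finset M) : Set (ℙ K (A → K)) :=
  {x | ∃ (t : Torus K τ) (h : (fun u : A => if (u : M) ∈ τ then (1 : K) else 0) ≠ 0),
    x ∈ translate t {Projectivization.mk K _ h}}

end Toric

/-! ### Cayley structures -/

section Cayley

/-- The lattice points `Δ_ℓ(d)` of the `d`-th dilate of the standard `ℓ`-simplex. -/
abbrev Simplex (ℓ d : ℕ) : Type := {v : Fin (ℓ + 1) → ℕ // ∑ i, v i = d}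

variable {M : Type*} [AddCommGroup M] {τ : Finset M} {ℓ d : ℕ}

/-- `π` is affine-linear: it is compatible with a group homomorphism from `⟨τ⟩` to `ℤ^{ℓ+1}`. -/
def IsAffineLinear (π : τ → Simplex ℓ d) : Prop :=
  ∃ L : diffLattice τ →+ (Fin (ℓ + 1) → ℤ),
    ∀ (u w : τ) (i : Fin (ℓ + 1)), L (diff u w) i = ((π u).1 i : ℤ) - (π w).1 i

/-- `π` is a Cayley structure of length `ℓ` and degree `d` on `τ`. -/
structure IsCayleyStructure (π : τ → Simplex ℓ d) : Prop where
  affineLinear : IsAffineLinear π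
  nonconstant : ∃ u w, π u ≠ π w
  basepointFree : ∀ i, ∃ u, (π u).1 i = 0
  concise : ∀ i, ∃ u, (π u).1 i ≠ 0

variable {K : Type*} [Field K]

open Classical in
/-- The forms `𝐟^{π(u)}`, `u ∈ A`, with the convention that they are `0` for `u ∉ τ`. -/
def cayleyForm (A : Finset M) (π : τ → Simplex ℓ d) (f : Fin (ℓ + 1) → MvPolynomial (Fin 2) K)
    (u : A) : MvPolynomial (Fin 2) K :=
  if h : (u : M) ∈ τ then ∏ i, f i ^ (π ⟨u, h⟩).1 i else 0

/-- The curve `C_{π,𝐟}`: the closure of the image of the rational map `y ↦ (𝐟^{π(u)}(y))_u` from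
the projective line. -/
def cayleyCurve (A : Finset M) (π : τ → Simplex ℓ d) (f : Fin (ℓ + 1) → MvPolynomial (Fin 2) K) :
    Set (ℙ K (A → K)) :=
  projClosure {x | ∃ y : Fin 2 → K, y ≠ 0 ∧
    ∃ h : (fun u : A => MvPolynomial.eval y (cayleyForm A π f u)) ≠ 0, x = Projectivization.mk K _ h}

end Cayley

/-! ### Marked points on the projective line -/

section Marked

variable (K : Type*) [Field K]

/-- The projective line. -/
abbrev Line : Type _ := ℙ K (Fin 2 → K)

/-- The points of `M_{0,ℓ+1}`: tuples of `ℓ + 1` distinct points on the projective line, up to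
automorphisms of the line. For `ℓ ≤ 1` this is a single point. -/
def MarkedLine (ℓ : ℕ) : Type _ :=
  MulAction.orbitRel.Quotient ((Fin 2 → K) ≃ₗ[K] (Fin 2 → K)) (Fin (ℓ + 1) ↪ Line K)

variable {K}

/-- The class of a tuple of distinct points. -/
def MarkedLine.mk {ℓ : ℕ} (P : Fin (ℓ + 1) ↪ Line K) : MarkedLine K ℓ :=
  Quotient.mk (MulAction.orbitRel ((Fin 2 → K) ≃ₗ[K] (Fin 2 → K)) (Fin (ℓ + 1) ↪ Line K)) P

/-- Relabelling of the marked points by a permutation `s`: the point with label `i` receives the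
label `s i`. (Allowing two lengths avoids a cast; a bijection `s` exists only if they agree.) -/
def MarkedLine.relabel {ℓ ℓ' : ℕ} (s : Fin (ℓ + 1) ≃ Fin (ℓ' + 1)) (p : MarkedLine K ℓ) :
    MarkedLine K ℓ' :=
  Quotient.map (fun P : Fin (ℓ + 1) ↪ Line K => s.symm.toEmbedding.trans P)
    (by
      rintro P Q ⟨g, rfl⟩
      exact ⟨g, by ext i; rfl⟩) p

/-- The point `(a : 1)` of the projective line. -/
def affinePoint (a : K) : Line K :=
  Projectivization.mk K ![a, 1] (fun h => one_ne_zero (congrFun h 1))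

/-- The point `(1 : 0)` of the projective line. -/
def infinitePoint : Line K :=
  Projectivization.mk K ![1, 0] (fun h => one_ne_zero (congrFun h 0))

/-- The coordinates in which the marked points are `P_0 = (1 : 0)` and `P_i = (c_i : 1)` for
`i > 0`, with `c_1 = 0` and `c_2 = 1` (as far as `ℓ` allows). -/
def IsNormalized {ℓ : ℕ} (P : Fin (ℓ + 1) ↪ Line K) (c : Fin (ℓ + 1) → K) : Prop :=
  P 0 = infinitePoint ∧ (∀ i, i ≠ 0 → P i = affinePoint (c i)) ∧
    (∀ i : Fin (ℓ + 1), (i : ℕ) = 1 → c i = 0) ∧ (∀ i : Fin (ℓ + 1), (i : ℕ) = 2 → c i = 1)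

theorem mk_eq_infinitePoint {v : Fin 2 → K} (hv : v ≠ 0) (h : v 1 = 0) :
    Projectivization.mk K v hv = infinitePoint := by
  have h0 : v 0 ≠ 0 := fun h0 => hv (by ext i; fin_cases i <;> simp [h, h0])
  rw [infinitePoint, Projectivization.mk_eq_mk_iff']
  exact ⟨v 0, by ext i; fin_cases i <;> simp [h]⟩

theorem mk_eq_affinePoint {v : Fin 2 → K} (hv : v ≠ 0) (h : v 1 ≠ 0) :
    Projectivization.mk K v hv = affinePoint (v 0 / v 1) := by
  rw [affinePoint, Projectivization.mk_eq_mk_iff']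
  exact ⟨v 1, by ext i; fin_cases i <;> simp [h, mul_div_cancel₀]⟩

theorem line_cases (x : Line K) : x = infinitePoint ∨ ∃ a : K, x = affinePoint a := by
  induction x using Projectivization.ind with
  | h v hv =>
    by_cases h : v 1 = 0
    · exact Or.inl (mk_eq_infinitePoint hv h)
    · exact Or.inr ⟨_, mk_eq_affinePoint hv h⟩

theorem infinitePoint_ne (a : K) : infinitePoint ≠ affinePoint a := by
  intro h
  rw [infinitePoint, affinePoint, Projectivization.mk_eq_mk_iff'] at h
  obtain ⟨b, hb⟩ := h
  have h1 := congrFun hb 1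
  have h0 := congrFun hb 0
  simp at h1 h0
  simp [h1] at h0

theorem affinePoint_injective : Function.Injective (affinePoint : K → Line K) := by
  intro a b h
  rw [affinePoint, affinePoint, Projectivization.mk_eq_mk_iff'] at h
  obtain ⟨e, he⟩ := h
  have h1 := congrFun he 1
  have h0 := congrFun he 0
  simp at h1 h0
  simpa [h1] using h0.symm

theorem exists_ne_ne (P Q : Line K) : ∃ R, R ≠ P ∧ R ≠ Q := by
  by_contra! h
  have h1 : (infinitePoint : Line K) ≠ affinePoint 0 := infinitePoint_ne 0
  have h2 : (infinitePoint : Line K) ≠ affinePoint 1 := infinitePoint_ne 1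
  have h3 : (affinePoint 0 : Line K) ≠ affinePoint 1 :=
    fun e => zero_ne_one (affinePoint_injective e)
  have k1 := h infinitePoint
  have k2 := h (affinePoint 0)
  have k3 := h (affinePoint 1)
  by_cases e1 : (infinitePoint : Line K) = P
  · exact h3 ((k2 (fun e => h1 (e1.trans e.symm))).trans (k3 (fun e => h2 (e1.trans e.symm))).symm)
  · by_cases e2 : (affinePoint 0 : Line K) = P
    · exact h2 ((k1 e1).trans (k3 (fun e => h3 (e2.trans e.symm))).symm)
    · exact h1 ((k1 e1).trans (k2 e2).symm)

theorem exists_smul_three {P Q R : Line K} (hPQ : P ≠ Q) (hRP : R ≠ P) (hRQ : R ≠ Q) :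
    ∃ g : (Fin 2 → K) ≃ₗ[K] (Fin 2 → K),
      g • P = infinitePoint ∧ g • Q = affinePoint 0 ∧ g • R = affinePoint 1 := by
  have htwo := Projectivization.linearEquiv_is_two_pretransitive K (Fin 2 → K)
  rw [MulAction.is_two_pretransitive_iff] at htwo
  obtain ⟨g, hP, hQ⟩ := htwo hPQ (infinitePoint_ne (0 : K))
  have hR1 : g • R ≠ infinitePoint := by
    rw [← hP]; exact fun h => hRP (MulAction.injective g h)
  have hR2 : g • R ≠ affinePoint 0 := by
    rw [← hQ]; exact fun h => hRQ (MulAction.injective g h)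
  obtain ⟨a, ha⟩ := (line_cases (g • R)).resolve_left hR1
  have ha0 : a ≠ 0 := by rintro rfl; exact hR2 ha
  let e : (Fin 2 → K) ≃ₗ[K] (Fin 2 → K) :=
    LinearEquiv.piCongrRight (fun i : Fin 2 =>
      LinearEquiv.smulOfNeZero K K (![a⁻¹, 1] i) (by fin_cases i <;> simp [ha0]))
  refine ⟨e * g, ?_, ?_, ?_⟩
  · rw [mul_smul, hP, infinitePoint, Projectivization.smul_mk]
    exact mk_eq_infinitePoint _ (by simp [e])
  · rw [mul_smul, hQ, affinePoint, Projectivization.smul_mk, mk_eq_affinePoint _ (by simp [e])]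
    simp [e, affinePoint]
  · rw [mul_smul, ha, affinePoint, Projectivization.smul_mk, mk_eq_affinePoint _ (by simp [e])]
    simp [e, affinePoint, ha0]

/-- Every point of `M_{0,ℓ+1}` can be written in normalized coordinates. -/
theorem MarkedLine.exists_normalized {ℓ : ℕ} (p : MarkedLine K ℓ) :
    ∃ c : Fin (ℓ + 1) → K, ∃ P : Fin (ℓ + 1) ↪ Line K, MarkedLine.mk P = p ∧ IsNormalized P c := by
  obtain ⟨P, rfl⟩ := Quotient.exists_rep p
  obtain ⟨Q, hQ, hQ'⟩ : ∃ Q, Q ≠ P 0 ∧ ∀ i : Fin (ℓ + 1), (i : ℕ) = 1 → P i = Q := by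
    by_cases h : 1 < ℓ + 1
    · refine ⟨P ⟨1, h⟩, fun e => ?_, fun i hi => congrArg P (Fin.ext hi)⟩
      simpa [Fin.ext_iff] using P.injective e
    · obtain ⟨Q, hQ, -⟩ := exists_ne_ne (P 0) (P 0)
      exact ⟨Q, hQ, fun i hi => absurd i.2 (by omega)⟩
  obtain ⟨R, hR, hRQ, hR'⟩ :
      ∃ R, R ≠ P 0 ∧ R ≠ Q ∧ ∀ i : Fin (ℓ + 1), (i : ℕ) = 2 → P i = R := by
    by_cases h : 2 < ℓ + 1
    · refine ⟨P ⟨2, h⟩, fun e => ?_, fun e => ?_, fun i hi => congrArg P (Fin.ext hi)⟩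
      · simpa [Fin.ext_iff] using P.injective e
      · rw [← hQ' ⟨1, by omega⟩ rfl] at e
        simpa [Fin.ext_iff] using P.injective e
    · obtain ⟨R, hR, hRQ⟩ := exists_ne_ne (P 0) Q
      exact ⟨R, hR, hRQ, fun i hi => absurd i.2 (by omega)⟩
  obtain ⟨g, hg0, hg1, hg2⟩ := exists_smul_three hQ.symm hR hRQ
  have key : ∀ i : Fin (ℓ + 1), ∃ a : K, i ≠ 0 → (g • P) i = affinePoint a := by
    intro i
    by_cases hi : i = 0
    · exact ⟨0, fun h => absurd hi h⟩
    · have hne : (g • P) i ≠ infinitePoint := by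
        rw [← hg0]
        exact fun h => hi ((g • P).injective h)
      obtain ⟨a, ha⟩ := (line_cases _).resolve_left hne
      exact ⟨a, fun _ => ha⟩
  choose c hc using key
  refine ⟨c, g • P, Quotient.sound ⟨g, rfl⟩, hg0, hc, fun i hi => ?_, fun i hi => ?_⟩
  · have h0 : i ≠ 0 := by rintro rfl; simp at hi
    apply affinePoint_injective
    rw [← hc i h0, ← hg1, ← hQ' i hi]
    rfl
  · have h0 : i ≠ 0 := by rintro rfl; simp at hi
    apply affinePoint_injective
    rw [← hc i h0, ← hg2, ← hR' i hi]
    rfl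

/-- The normalized coordinates `c_i` of a point of `M_{0,ℓ+1}` (the entry at `0` is not used). -/
def MarkedLine.coord {ℓ : ℕ} (p : MarkedLine K ℓ) : Fin (ℓ + 1) → K :=
  p.exists_normalized.choose

/-- The tuple of linear forms `𝐟(p) = (y₁, y₀, y₀ - y₁, y₀ - c₃ y₁, …, y₀ - c_ℓ y₁)`. -/
def MarkedLine.forms {ℓ : ℕ} (p : MarkedLine K ℓ) (i : Fin (ℓ + 1)) : MvPolynomial (Fin 2) K :=
  if i = 0 then MvPolynomial.X 1
  else MvPolynomial.X 0 - MvPolynomial.C (p.coord i) * MvPolynomial.X 1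

end Marked

end ToricCurves

end

noncomputable section

namespace ToricCurves

open MvPolynomial

/-! ### Homogeneous polynomials and the projective Nullstellensatz. -/

section Forms

variable {K : Type*} [Field K] {σ : Type*}

/-! The theorem rests on unique factorization of binary forms. Dividing a birational parametrization
of `C` by its greatest common divisor gives forms `ψ u` of one degree without common zero, and
`I(C)` is the kernel of `x_u ↦ ψ u` (`exists_hasNoCommonZero_of_isBirationalToLine`). The Hilbert
function of `C` counts polynomials of degree `m` in the `ψ u`. It is at most the dimension of all
forms of the corresponding degree, and the rational inverse bounds it below by the same linear
growth, so the `ψ u` have degree `d` (`degree_eq_of_isRationalInverse`).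

Existence: `ψ u` is nonzero exactly for `u ∈ τ`, by the dense orbit on one side and the equations of
`X_τ` on the other. The marked points are all zeros of these forms, and `π u` records the
multiplicities of the zeros of `ψ u`. Absence of common zeros is basepoint-freeness. Each binomial
equation of `X_τ` becomes an identity between products of linear forms. Comparing exponents makes
`π` affine-linear; comparing constants makes the leading coefficients a point of the torus
(`exists_torus_of_toricIdeal_le`).

Uniqueness: composing any parametrization of degree `d` without common zero with the rational
inverse gives a self-map of the line, of degree one by comparison of degrees. So two such
parametrizations differ by an automorphism of the line and a constant
(`exists_eq_C_mul_substitute`). Multiplicities of zeros then match exponents and marked points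
(`exists_equiv_of_eq_substitute`).

Finiteness: a torus element stabilizing `C` induces an automorphism of the line that permutes the
marked points. If there are at least three of them, the permutation determines the automorphism,
hence the torus element, so the stabilizer injects into a finite symmetric group. -/

theorem homogeneousComponent_mul_of_isHomogeneous {p : MvPolynomial σ K} {a : ℕ}
    (hp : p.IsHomogeneous a) (b : ℕ) (q : MvPolynomial σ K) :
    homogeneousComponent (a + b) (p * q) = p * homogeneousComponent b q := by
  conv_lhs => rw [← sum_homogeneousComponent q]
  rw [Finset.mul_sum, map_sum]
  have h : ∀ i, homogeneousComponent (a + b) (p * homogeneousComponent i q) =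
      if i = b then p * homogeneousComponent b q else 0 := by
    intro i
    rw [homogeneousComponent_of_mem (hp.mul (homogeneousComponent_isHomogeneous i q))]
    by_cases hi : i = b
    · simp [hi]
    · rw [if_neg (by omega), if_neg hi]
  simp only [h, Finset.sum_ite_eq', Finset.mem_range]
  split_ifs with hb
  · rfl
  · rw [homogeneousComponent_eq_zero _ _ (by omega), mul_zero]

theorem IsHomogeneous.exists_eq_mul {p q : MvPolynomial σ K} {a b : ℕ} (hp : p.IsHomogeneous a)
    (hq : q.IsHomogeneous (a + b)) (h : p ∣ q) : ∃ r, r.IsHomogeneous b ∧ q = p * r := by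
  obtain ⟨r, rfl⟩ := h
  refine ⟨homogeneousComponent b r, homogeneousComponent_isHomogeneous b r, ?_⟩
  rw [← homogeneousComponent_mul_of_isHomogeneous hp, homogeneousComponent_eq_self hq]

/-- The factor `c` lies in an algebra because it will also be a polynomial: the common divisor of a
parametrization, or the factor `h` in `F ∘ G = h * X`. -/
theorem IsHomogeneous.aeval_smul {S : Type*} [CommRing S] [Algebra K S] {p : MvPolynomial σ K}
    {n : ℕ} (hp : p.IsHomogeneous n) (c : S) (v : σ → S) :
    aeval (fun i => c * v i) p = c ^ n * aeval v p := by
  rw [aeval_def, aeval_def, eval₂_eq, eval₂_eq, Finset.mul_sum]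
  refine Finset.sum_congr rfl fun d hd => ?_
  have hd' := hp.degree_eq_sum_deg_support hd
  simp only [mul_pow, Finset.prod_mul_distrib, Finset.prod_pow_eq_pow_sum]
  rw [hd']
  ring

theorem IsHomogeneous.eval_smul {p : MvPolynomial σ K} {n : ℕ} (hp : p.IsHomogeneous n) (c : K)
    (v : σ → K) : eval (c • v) p = c ^ n * eval v p := by
  simpa only [aeval_eq_eval] using! IsHomogeneous.aeval_smul hp c v

/-- By the Nullstellensatz the coordinates lie in the radical, since the zero locus is contained in
the origin. Finiteness of `σ` gives one exponent for all. -/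
theorem exists_X_pow_mem [IsAlgClosed K] [Finite σ] (I : Ideal (MvPolynomial σ K))
    (h : ∀ y : σ → K, y ≠ 0 → ∃ q ∈ I, eval y q ≠ 0) : ∃ k : ℕ, ∀ j, X j ^ k ∈ I := by
  have key : ∀ j, ∃ k : ℕ, X j ^ k ∈ I := by
    intro j
    have hj : X j ∈ I.radical := by
      rw [← vanishingIdeal_zeroLocus_eq_radical (K := K), mem_vanishingIdeal_iff]
      intro x hx
      have hx0 : x = 0 := by
        by_contra hx0
        obtain ⟨q, hq, hne⟩ := h x hx0
        exact hne (hx q hq)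
      simp [hx0]
    exact hj
  choose k hk using key
  classical
  cases nonempty_fintype σ
  refine ⟨∑ j, k j, fun j => ?_⟩
  rw [← Finset.add_sum_erase _ _ (Finset.mem_univ j), pow_add]
  exact I.mul_mem_right _ (hk j)

end Forms

/-! ### Linear factors of binary forms. -/

section LineForm

variable {K : Type*} [Field K]

/-- The linear form that vanishes exactly at the point `P` of the line. -/
def lineForm (P : Line K) : MvPolynomial (Fin 2) K := C (P.rep 1) * X 0 - C (P.rep 0) * X 1

@[simp]
theorem eval_lineForm (P : Line K) (y : Fin 2 → K) :
    eval y (lineForm P) = P.rep 1 * y 0 - P.rep 0 * y 1 := by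
  simp [lineForm]

theorem isHomogeneous_lineForm (P : Line K) : (lineForm P).IsHomogeneous 1 :=
  (isHomogeneous_C_mul_X _ _).sub (isHomogeneous_C_mul_X _ _)

theorem eval_lineForm_eq_zero_iff {P : Line K} {y : Fin 2 → K} (hy : y ≠ 0) :
    eval y (lineForm P) = 0 ↔ Projectivization.mk K y hy = P := by
  conv_rhs => rw [← P.mk_rep, Projectivization.mk_eq_mk_iff']
  have hP := P.rep_nonzero
  rw [eval_lineForm]
  constructor
  · intro h
    by_cases h1 : P.rep 1 = 0
    · have h0 : P.rep 0 ≠ 0 := fun h0 => hP (by ext i; fin_cases i <;> simp [h1, h0])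
      refine ⟨y 0 / P.rep 0, ?_⟩
      ext i
      fin_cases i
      · simp [h0]
      · simp only [h1, zero_mul, zero_sub, neg_eq_zero, mul_eq_zero, h0, false_or] at h
        simp [h1, h]
    · refine ⟨y 1 / P.rep 1, ?_⟩
      ext i
      fin_cases i
      · simp only [Fin.zero_eta, Pi.smul_apply, smul_eq_mul]
        field_simp
        linear_combination -h
      · simp [h1]
  · rintro ⟨a, rfl⟩
    simp only [Pi.smul_apply, smul_eq_mul]
    ring

theorem lineForm_ne_zero (P : Line K) : lineForm P ≠ 0 := by
  intro h
  obtain ⟨Q, hQ, -⟩ := exists_ne_ne P P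
  refine hQ ?_
  rw [← Q.mk_rep, ← eval_lineForm_eq_zero_iff, h, map_zero]

/-- Restriction of polynomials to the line spanned by a vector. -/
def restrictToSpan (v : Fin 2 → K) : MvPolynomial (Fin 2) K →ₐ[K] Polynomial K :=
  aeval fun j => Polynomial.X * Polynomial.C (v j)

/-- Modulo the line form, every variable is a multiple of `X k` for any `k` with `P.rep k ≠ 0`, so
restriction to the line through `P.rep` can be undone by sending the parameter to `X k / P.rep k`.
The quotient thus embeds in `K[X]`, which also yields primality. -/
theorem lineForm_dvd_iff {P : Line K} {F : MvPolynomial (Fin 2) K} :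
    lineForm P ∣ F ↔ restrictToSpan P.rep F = 0 := by
  constructor
  · rintro ⟨G, rfl⟩
    have : restrictToSpan P.rep (lineForm P) = 0 := by
      simp [restrictToSpan, lineForm]
      simp only [Polynomial.C_eq_algebraMap]
      ring
    rw [map_mul, this, zero_mul]
  · intro h
    obtain ⟨k, hk⟩ : ∃ k, P.rep k ≠ 0 := by
      by_contra! hk
      exact P.rep_nonzero (funext hk)
    have key : (Ideal.Quotient.mkₐ K (Ideal.span {lineForm P})) =
        ((Ideal.Quotient.mkₐ K (Ideal.span {lineForm P})).comp
          (Polynomial.aeval (C (P.rep k)⁻¹ * X k : MvPolynomial (Fin 2) K))).comp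
            (restrictToSpan P.rep) := by
      ext j
      simp only [AlgHom.comp_apply, restrictToSpan, aeval_X, Ideal.Quotient.mkₐ_eq_mk]
      rw [Ideal.Quotient.mk_eq_mk_iff_sub_mem, Ideal.mem_span_singleton]
      simp only [map_mul, Polynomial.aeval_X, Polynomial.aeval_C, algebraMap_eq]
      have hk' : (C (P.rep k) * C (P.rep k)⁻¹ : MvPolynomial (Fin 2) K) = 1 := by
        rw [← C_mul, mul_inv_cancel₀ hk, C_1]
      fin_cases j <;> fin_cases k <;> simp only [Fin.zero_eta, Fin.mk_one, lineForm] at hk' ⊢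
      · exact ⟨0, by linear_combination -X 0 * hk'⟩
      · exact ⟨C (P.rep 1)⁻¹, by linear_combination -X 0 * hk'⟩
      · exact ⟨-C (P.rep 0)⁻¹, by linear_combination -X 1 * hk'⟩
      · exact ⟨0, by linear_combination -X 1 * hk'⟩
    have := DFunLike.congr_fun key F
    rw [AlgHom.comp_apply, h, map_zero, Ideal.Quotient.mkₐ_eq_mk, Ideal.Quotient.eq_zero_iff_mem,
      Ideal.mem_span_singleton] at this
    exact this

theorem prime_lineForm (P : Line K) : Prime (lineForm P) := by
  refine ⟨lineForm_ne_zero P, fun h => ?_, fun F G h => ?_⟩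
  · rw [isUnit_iff_dvd_one, lineForm_dvd_iff, map_one] at h
    exact one_ne_zero h
  · rw [lineForm_dvd_iff, map_mul, mul_eq_zero] at h
    simpa only [lineForm_dvd_iff] using h

/-- By homogeneity, the restriction to the span of `P.rep` is `X ^ n` times the value at `P.rep`. -/
theorem lineForm_dvd_of_eval_eq_zero {P : Line K} {F : MvPolynomial (Fin 2) K} {n : ℕ}
    (hF : F.IsHomogeneous n) (h : eval P.rep F = 0) : lineForm P ∣ F := by
  rw [lineForm_dvd_iff, restrictToSpan, IsHomogeneous.aeval_smul hF]
  have : aeval (fun i => Polynomial.C (P.rep i)) F = Polynomial.C (eval P.rep F) := by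
    exact (aeval_algebraMap_apply (Polynomial K) P.rep F)
  rw [this, h, map_zero, mul_zero]

theorem eval_eq_zero_of_lineForm_dvd {P : Line K} {F : MvPolynomial (Fin 2) K}
    (h : lineForm P ∣ F) : eval P.rep F = 0 := by
  obtain ⟨G, rfl⟩ := h
  rw [map_mul, (eval_lineForm_eq_zero_iff P.rep_nonzero).2 P.mk_rep, zero_mul]

theorem lineForm_dvd_lineForm_iff {P Q : Line K} : lineForm P ∣ lineForm Q ↔ P = Q := by
  refine ⟨fun h => ?_, fun h => h ▸ dvd_rfl⟩
  have := eval_eq_zero_of_lineForm_dvd h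
  rwa [eval_lineForm_eq_zero_iff P.rep_nonzero, P.mk_rep] at this

/-- A form of positive degree in two variables has a linear factor. -/
theorem exists_lineForm_dvd [IsAlgClosed K] {F : MvPolynomial (Fin 2) K} {n : ℕ}
    (hF : F.IsHomogeneous n) (hn : n ≠ 0) : ∃ P : Line K, lineForm P ∣ F := by
  suffices h : ∃ y : Fin 2 → K, y ≠ 0 ∧ eval y F = 0 by
    obtain ⟨y, hy, h⟩ := h
    refine ⟨Projectivization.mk K y hy, lineForm_dvd_of_eval_eq_zero hF ?_⟩
    obtain ⟨a, ha⟩ := Projectivization.exists_smul_eq_mk_rep K y hy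
    rw [← ha, Units.smul_def, IsHomogeneous.eval_smul hF, h, mul_zero]
  by_contra! h
  -- Without a nontrivial zero, `F` divides powers of both variables. These are coprime, so `F` is
  -- constant, against `n ≠ 0`.
  obtain ⟨k, hk⟩ := exists_X_pow_mem (Ideal.span {F})
    fun y hy => ⟨F, Ideal.mem_span_singleton_self F, h y hy⟩
  simp only [Ideal.mem_span_singleton] at hk
  obtain ⟨i, -, hi⟩ := (dvd_prime_pow (X_prime (R := K) (i := (0 : Fin 2))) k).1 (hk 0)
  have hi0 : i = 0 := by
    by_contra hi0
    have h1 : (X 0 : MvPolynomial (Fin 2) K) ∣ X 1 ^ k :=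
      (dvd_pow_self _ hi0).trans (hi.symm.dvd.trans (hk 1))
    obtain ⟨G, hG⟩ := h1
    have := congrArg (eval ![0, 1]) hG
    simp at this
  rw [hi0, pow_zero, associated_one_iff_isUnit] at hi
  obtain ⟨c, -, hc⟩ := MvPolynomial.isUnit_iff_eq_C_of_isReduced.1 hi
  have hF0 : F ≠ 0 := hi.ne_zero
  exact hn (hF.inj_right (hc ▸ isHomogeneous_C _ c) hF0)

theorem exists_eq_prod_lineForm [IsAlgClosed K] {n : ℕ} {F : MvPolynomial (Fin 2) K}
    (hF : F.IsHomogeneous n) (hF0 : F ≠ 0) :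
    ∃ (c : K) (s : Multiset (Line K)), c ≠ 0 ∧ F = C c * (s.map lineForm).prod := by
  induction n generalizing F with
  | zero =>
    rw [← totalDegree_zero_iff_isHomogeneous, totalDegree_eq_zero_iff_eq_C] at hF
    refine ⟨coeff 0 F, 0, fun h => hF0 ?_, by simpa using hF⟩
    rw [hF, h, C_0]
  | succ n ih =>
    obtain ⟨P, hP⟩ := exists_lineForm_dvd hF n.succ_ne_zero
    obtain ⟨r, hr, rfl⟩ :=
      IsHomogeneous.exists_eq_mul (isHomogeneous_lineForm P) (by rwa [add_comm]) hP
    obtain ⟨c, s, hc, rfl⟩ := ih hr (right_ne_zero_of_mul hF0)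
    exact ⟨c, P ::ₘ s, hc, by simp; ring⟩

end LineForm

/-! ### Families of binary forms without common zero. -/

section CommonZeros

variable {K : Type*} [Field K] {ι : Type*}

theorem lineForm_mk_dvd_iff {F : MvPolynomial (Fin 2) K} {n : ℕ} (hF : F.IsHomogeneous n)
    {y : Fin 2 → K} (hy : y ≠ 0) : lineForm (Projectivization.mk K y hy) ∣ F ↔ eval y F = 0 := by
  obtain ⟨a, ha⟩ := Projectivization.exists_smul_eq_mk_rep K y hy
  constructor
  · intro h
    have := eval_eq_zero_of_lineForm_dvd h
    rw [← ha, Units.smul_def, IsHomogeneous.eval_smul hF] at this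
    exact (mul_eq_zero.1 this).resolve_left (pow_ne_zero _ a.ne_zero)
  · intro h
    refine lineForm_dvd_of_eval_eq_zero hF ?_
    rw [← ha, Units.smul_def, IsHomogeneous.eval_smul hF, h, mul_zero]

/-- The binary forms `φ u` have no common zero on the line. -/
def HasNoCommonZero (φ : ι → MvPolynomial (Fin 2) K) : Prop :=
  ∀ y : Fin 2 → K, y ≠ 0 → ∃ u, eval y (φ u) ≠ 0

theorem HasNoCommonZero.exists_ne_zero {φ : ι → MvPolynomial (Fin 2) K}
    (h : HasNoCommonZero φ) : ∃ u, φ u ≠ 0 := by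
  obtain ⟨u, hu⟩ := h ![1, 0] (fun h => one_ne_zero (congrFun h 0))
  exact ⟨u, fun h => hu (by rw [h, map_zero])⟩

theorem IsHomogeneous.exists_eq_C {σ : Type*} {F : MvPolynomial σ K} (hF : F.IsHomogeneous 0) :
    ∃ c, F = C c := by
  rw [← totalDegree_zero_iff_isHomogeneous, totalDegree_eq_zero_iff_eq_C] at hF
  exact ⟨_, hF⟩

theorem IsHomogeneous.exists_eq_C_ne_zero {σ : Type*} {F : MvPolynomial σ K}
    (hF : F.IsHomogeneous 0) (h : F ≠ 0) : ∃ c, c ≠ 0 ∧ F = C c := by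
  obtain ⟨c, rfl⟩ := IsHomogeneous.exists_eq_C hF
  exact ⟨c, fun hc => h (by rw [hc, C_0]), rfl⟩

/-- Splitting off the greatest common divisor of a family of binary forms. -/
theorem exists_eq_mul_hasNoCommonZero {n : ℕ} {F : ι → MvPolynomial (Fin 2) K}
    (hF : ∀ u, (F u).IsHomogeneous n) (h : ∃ u, F u ≠ 0) :
    ∃ (m e : ℕ) (g : MvPolynomial (Fin 2) K) (f : ι → MvPolynomial (Fin 2) K),
      g.IsHomogeneous m ∧ g ≠ 0 ∧ (∀ u, (f u).IsHomogeneous e) ∧ HasNoCommonZero f ∧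
      ∀ u, F u = g * f u := by
  induction n generalizing F with
  | zero =>
    refine ⟨0, 0, 1, F, isHomogeneous_one _ _, one_ne_zero, hF, fun y _ => ?_,
      fun u => (one_mul _).symm⟩
    obtain ⟨u, hu⟩ := h
    obtain ⟨c, hc, hcu⟩ := IsHomogeneous.exists_eq_C_ne_zero (hF u) hu
    exact ⟨u, by rwa [hcu, eval_C]⟩
  | succ n ih =>
    by_cases hz : HasNoCommonZero F
    · exact ⟨0, n + 1, 1, F, isHomogeneous_one _ _, one_ne_zero, hF, hz, fun u => (one_mul _).symm⟩
    · simp only [HasNoCommonZero, not_forall, not_exists, not_not] at hz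
      obtain ⟨y, hy, hz⟩ := hz
      have hd := fun u => IsHomogeneous.exists_eq_mul
        (isHomogeneous_lineForm (Projectivization.mk K y hy)) (by simpa only [add_comm] using hF u)
        ((lineForm_mk_dvd_iff (hF u) hy).2 (hz u))
      choose r hr hFr using hd
      obtain ⟨m, e, g, f, hg, hg0, hf, hf0, hgf⟩ := ih hr (by
        obtain ⟨u, hu⟩ := h
        exact ⟨u, fun h0 => hu (by rw [hFr, h0, mul_zero])⟩)
      refine ⟨1 + m, e, lineForm (Projectivization.mk K y hy) * g, f,
        (isHomogeneous_lineForm _).mul hg, mul_ne_zero (lineForm_ne_zero _) hg0, hf, hf0,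
        fun u => ?_⟩
      rw [hFr, hgf, mul_assoc]

/-- Two proportional families of binary forms, both without common zeros, differ by a constant. -/
theorem exists_eq_C_mul [IsAlgClosed K] {φ θ : ι → MvPolynomial (Fin 2) K}
    (hφ : HasNoCommonZero φ) (hθ : HasNoCommonZero θ) {m n : ℕ} {p q : MvPolynomial (Fin 2) K}
    (hp : p.IsHomogeneous m) (hq : q.IsHomogeneous n) (hp0 : p ≠ 0) (hq0 : q ≠ 0)
    (h : ∀ u, p * φ u = q * θ u) : ∃ c : K, c ≠ 0 ∧ ∀ u, φ u = C c * θ u := by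
  induction m generalizing n p q with
  | zero =>
    obtain ⟨a, ha, rfl⟩ := IsHomogeneous.exists_eq_C_ne_zero hp hp0
    -- A zero of `q` would be a common zero of the `φ u`, because here `p` is a nonzero constant.
    have hn : n = 0 := by
      by_contra hn
      obtain ⟨P, hP⟩ := exists_lineForm_dvd hq hn
      obtain ⟨u, hu⟩ := hφ P.rep P.rep_nonzero
      have := congrArg (eval P.rep) (h u)
      rw [map_mul, map_mul, eval_eq_zero_of_lineForm_dvd hP, zero_mul, eval_C] at this
      exact mul_ne_zero ha hu this
    subst hn
    obtain ⟨b, hb, rfl⟩ := IsHomogeneous.exists_eq_C_ne_zero hq hq0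
    refine ⟨a⁻¹ * b, mul_ne_zero (inv_ne_zero ha) hb, fun u => ?_⟩
    rw [C_mul, mul_assoc, ← h u, ← mul_assoc, ← C_mul, inv_mul_cancel₀ ha, C_1, one_mul]
  | succ m ih =>
    obtain ⟨P, hP⟩ := exists_lineForm_dvd hp m.succ_ne_zero
    obtain ⟨u, hu⟩ := hθ P.rep P.rep_nonzero
    -- Some `θ u` is nonzero at the zero `P` of `p`, so `q` vanishes there and the factor can be
    -- cancelled from both sides.
    have hPq : eval P.rep q = 0 := by
      have := congrArg (eval P.rep) (h u)
      rw [map_mul, map_mul, eval_eq_zero_of_lineForm_dvd hP, zero_mul] at this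
      exact (mul_eq_zero.1 this.symm).resolve_right hu
    obtain _ | n := n
    · obtain ⟨b, hb, rfl⟩ := IsHomogeneous.exists_eq_C_ne_zero hq hq0
      rw [eval_C] at hPq
      exact absurd hPq hb
    · obtain ⟨r, hr, rfl⟩ :=
        IsHomogeneous.exists_eq_mul (isHomogeneous_lineForm P) (by rwa [add_comm]) hP
      obtain ⟨s, hs, rfl⟩ := IsHomogeneous.exists_eq_mul (isHomogeneous_lineForm P)
        (by rwa [add_comm]) (lineForm_dvd_of_eval_eq_zero hq hPq)
      refine ih hr hs (right_ne_zero_of_mul hp0) (right_ne_zero_of_mul hq0) fun v => ?_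
      have := h v
      rw [mul_assoc, mul_assoc] at this
      exact mul_left_cancel₀ (lineForm_ne_zero P) this

end CommonZeros

/-! ### The action of linear automorphisms on binary forms. -/

section Substitution

variable {K : Type*} [Field K]

/-- The pullback of polynomials by a linear automorphism of the plane. -/
def substitute (g : (Fin 2 → K) ≃ₗ[K] (Fin 2 → K)) :
    MvPolynomial (Fin 2) K →ₐ[K] MvPolynomial (Fin 2) K :=
  aeval fun j => ∑ k, C (g (Pi.single k 1) j) * X k

@[simp]
theorem eval_substitute (g : (Fin 2 → K) ≃ₗ[K] (Fin 2 → K)) (y : Fin 2 → K)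
    (F : MvPolynomial (Fin 2) K) : eval y (substitute g F) = eval (g y) F := by
  have hg : g y = fun j => ∑ k, g (Pi.single k 1) j * y k := by
    conv_lhs => rw [← Finset.univ_sum_single y]
    ext j
    rw [map_sum, Finset.sum_apply]
    refine Finset.sum_congr rfl fun k _ => ?_
    have : (Pi.single k (y k) : Fin 2 → K) = y k • Pi.single k 1 := by
      rw [← Pi.single_smul, smul_eq_mul, mul_one]
    rw [this, map_smul, Pi.smul_apply, smul_eq_mul, mul_comm]
  have : (aeval y).comp (substitute g) = aeval (g y) := by
    ext j
    rw [AlgHom.comp_apply, substitute, aeval_X, aeval_X, hg, aeval_eq_eval]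
    simp
  exact DFunLike.congr_fun this F

theorem substitute_isHomogeneous (g : (Fin 2 → K) ≃ₗ[K] (Fin 2 → K)) {F : MvPolynomial (Fin 2) K}
    {n : ℕ} (hF : F.IsHomogeneous n) : (substitute g F).IsHomogeneous n := by
  have := hF.aeval (fun j => ∑ k, C (g (Pi.single k 1) j) * X k) (n := 1)
    fun j => IsHomogeneous.sum _ _ _ fun k _ => isHomogeneous_C_mul_X _ _
  rwa [one_mul] at this

variable [Infinite K]

/-- Pullback is contravariant, hence the reversed order `h * g`. Over an infinite field it is enough
to compare values. -/
theorem substitute_substitute (g h : (Fin 2 → K) ≃ₗ[K] (Fin 2 → K)) (F : MvPolynomial (Fin 2) K) :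
    substitute g (substitute h F) = substitute (h * g) F :=
  MvPolynomial.funext fun y => by simp

@[simp]
theorem substitute_one (F : MvPolynomial (Fin 2) K) : substitute 1 F = F :=
  MvPolynomial.funext fun y => by simp

theorem substitute_injective (g : (Fin 2 → K) ≃ₗ[K] (Fin 2 → K)) :
    Function.Injective (substitute g) := by
  refine Function.LeftInverse.injective (g := substitute g⁻¹) fun F => ?_
  rw [substitute_substitute, mul_inv_cancel, substitute_one]

/-- The pullback vanishes at `P`, so it is a multiple of `lineForm P`. The cofactor is constant by
degree, and nonzero because pullback is injective. -/
theorem substitute_lineForm (g : (Fin 2 → K) ≃ₗ[K] (Fin 2 → K)) (P : Line K) :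
    ∃ c : K, c ≠ 0 ∧ substitute g (lineForm (g • P)) = C c * lineForm P := by
  have hhom := substitute_isHomogeneous g (isHomogeneous_lineForm (g • P))
  have h0 : eval P.rep (substitute g (lineForm (g • P))) = 0 := by
    rw [eval_substitute, eval_lineForm_eq_zero_iff (by simpa using P.rep_nonzero)]
    conv_rhs => rw [← P.mk_rep, Projectivization.smul_mk]
    rfl
  obtain ⟨r, hr, h⟩ := IsHomogeneous.exists_eq_mul (b := 0) (isHomogeneous_lineForm P) hhom
    (lineForm_dvd_of_eval_eq_zero hhom h0)
  obtain ⟨c, hc, rfl⟩ := IsHomogeneous.exists_eq_C_ne_zero hr (by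
    rintro rfl
    rw [mul_zero] at h
    exact lineForm_ne_zero _ (substitute_injective g (h.trans (map_zero _).symm)))
  exact ⟨c, hc, by rw [h, mul_comm]⟩

theorem pow_lineForm_dvd_substitute (g : (Fin 2 → K) ≃ₗ[K] (Fin 2 → K)) {P : Line K} {n : ℕ}
    {F : MvPolynomial (Fin 2) K} (h : lineForm (g • P) ^ n ∣ F) :
    lineForm P ^ n ∣ substitute g F := by
  obtain ⟨c, -, hc⟩ := substitute_lineForm g P
  obtain ⟨G, rfl⟩ := h
  rw [map_mul, map_pow, hc, mul_pow, mul_assoc, mul_left_comm]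
  exact dvd_mul_right _ _

theorem emultiplicity_substitute (g : (Fin 2 → K) ≃ₗ[K] (Fin 2 → K)) (P : Line K)
    (F : MvPolynomial (Fin 2) K) :
    emultiplicity (lineForm P) (substitute g F) = emultiplicity (lineForm (g • P)) F := by
  rw [emultiplicity_eq_emultiplicity_iff]
  refine fun n => ⟨fun h => ?_, pow_lineForm_dvd_substitute g⟩
  have := pow_lineForm_dvd_substitute g⁻¹ (P := g • P) (F := substitute g F) (n := n)
    (by rwa [inv_smul_smul])
  rwa [substitute_substitute, mul_inv_cancel, substitute_one] at this

/-- Two linear forms without common zero define a linear automorphism of the plane. -/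
theorem exists_linearEquiv_of_hasNoCommonZero {a : Fin 2 → MvPolynomial (Fin 2) K}
    (ha : ∀ j, (a j).IsHomogeneous 1) (h : HasNoCommonZero a) :
    ∃ g : (Fin 2 → K) ≃ₗ[K] (Fin 2 → K), ∀ F, bind₁ a F = substitute g F := by
  have hlin : ∀ j, ∃ c : Fin 2 → K, a j = ∑ k, C (c k) * X k := by
    intro j
    have := (mem_homogeneousSubmodule 1 (a j)).2 (ha j)
    rw [homogeneousSubmodule_one_eq_span_X, Submodule.mem_span_range_iff_exists_fun] at this
    obtain ⟨c, hc⟩ := this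
    exact ⟨c, by simp only [← hc, smul_eq_C_mul]⟩
  choose c hc using hlin
  have heval : ∀ (y : Fin 2 → K) j, eval y (a j) = Matrix.mulVec (Matrix.of c) y j := by
    intro y j
    simp [hc, Matrix.mulVec, dotProduct]
  -- A nonzero kernel vector of the coefficient matrix would be a common zero of the two linear
  -- forms.
  let g := LinearEquiv.ofInjectiveEndo (Matrix.mulVecLin (Matrix.of c)) (by
    rw [← LinearMap.ker_eq_bot, LinearMap.ker_eq_bot']
    intro y hy
    by_contra hy0
    obtain ⟨j, hj⟩ := h y hy0
    exact hj (by rw [heval, ← Matrix.mulVecLin_apply, hy, Pi.zero_apply]))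
  refine ⟨g, fun F => MvPolynomial.funext fun y => ?_⟩
  rw [eval_substitute]
  have : (aeval y).comp (bind₁ a) = aeval (g y) := by
    ext j
    rw [AlgHom.comp_apply, bind₁_X_right, aeval_X, aeval_eq_eval, heval]
    rfl
  exact DFunLike.congr_fun this F

end Substitution

/-! ### Multiplicities of zeros of products of linear forms. -/

section Multiplicity

variable {K : Type*} [Field K] {ι : Type*} [Fintype ι]

theorem emultiplicity_lineForm_C (P : Line K) {c : K} (hc : c ≠ 0) :
    emultiplicity (lineForm P) (C c) = 0 := by
  rw [emultiplicity_eq_zero]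
  intro h
  have := eval_eq_zero_of_lineForm_dvd h
  rw [eval_C] at this
  exact hc this

open Classical in
theorem emultiplicity_lineForm_prod {f : ι → MvPolynomial (Fin 2) K} {P : ι → Line K}
    (hf : ∀ i, ∃ k : K, k ≠ 0 ∧ f i = C k * lineForm (P i)) {c : K} (hc : c ≠ 0) (a : ι → ℕ)
    (Q : Line K) :
    emultiplicity (lineForm Q) (C c * ∏ i, f i ^ a i) =
      ((∑ i, if P i = Q then a i else 0 : ℕ) : ℕ∞) := by
  have hp := prime_lineForm Q
  rw [emultiplicity_mul hp, emultiplicity_lineForm_C Q hc, zero_add,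
    Finset.emultiplicity_prod hp, Nat.cast_sum]
  refine Finset.sum_congr rfl fun i _ => ?_
  obtain ⟨k, hk, hfi⟩ := hf i
  rw [emultiplicity_pow hp, hfi, emultiplicity_mul hp, emultiplicity_lineForm_C Q hk, zero_add]
  split_ifs with h
  · rw [h, (FiniteMultiplicity.of_prime_left hp hp.ne_zero).emultiplicity_self, mul_one]
  · rw [emultiplicity_eq_zero.2, mul_zero, Nat.cast_zero]
    exact fun hd => h (lineForm_dvd_lineForm_iff.1 hd).symm

theorem emultiplicity_lineForm_prod_self {f : ι → MvPolynomial (Fin 2) K} {P : ι → Line K}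
    (hP : Function.Injective P) (hf : ∀ i, ∃ k : K, k ≠ 0 ∧ f i = C k * lineForm (P i))
    {c : K} (hc : c ≠ 0) (a : ι → ℕ) (i : ι) :
    emultiplicity (lineForm (P i)) (C c * ∏ i, f i ^ a i) = a i := by
  classical
  rw [emultiplicity_lineForm_prod hf hc]
  simp [hP.eq_iff]

theorem exists_of_emultiplicity_lineForm_prod_ne_zero {f : ι → MvPolynomial (Fin 2) K}
    {P : ι → Line K} (hf : ∀ i, ∃ k : K, k ≠ 0 ∧ f i = C k * lineForm (P i))
    {c : K} (hc : c ≠ 0) (a : ι → ℕ) {Q : Line K}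
    (h : emultiplicity (lineForm Q) (C c * ∏ i, f i ^ a i) ≠ 0) : ∃ i, P i = Q := by
  classical
  rw [emultiplicity_lineForm_prod hf hc] at h
  by_contra! hne
  exact h (by simp [hne])

/-- The multiplicity at `P i` recovers the exponent `a i` because the points are distinct;
cancelling the product leaves the constants. This splits a binomial relation into one on exponents
and one on coefficients. -/
theorem eq_of_C_mul_prod_eq {f : ι → MvPolynomial (Fin 2) K} {P : ι → Line K}
    (hP : Function.Injective P) (hf : ∀ i, ∃ k : K, k ≠ 0 ∧ f i = C k * lineForm (P i))
    {c c' : K} (hc : c ≠ 0) (hc' : c' ≠ 0) {a a' : ι → ℕ}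
    (h : C c * ∏ i, f i ^ a i = C c' * ∏ i, f i ^ a' i) : c = c' ∧ a = a' := by
  have ha : a = a' := by
    ext i
    have h1 := emultiplicity_lineForm_prod_self hP hf hc a i
    rw [h, emultiplicity_lineForm_prod_self hP hf hc' a' i] at h1
    exact_mod_cast h1.symm
  subst ha
  refine ⟨C_injective _ _ (mul_right_cancel₀ (Finset.prod_ne_zero_iff.2 fun i _ => ?_) h), rfl⟩
  obtain ⟨k, hk, hfi⟩ := hf i
  rw [hfi]
  exact pow_ne_zero _ (mul_ne_zero (by simpa using hk) (lineForm_ne_zero _))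

end Multiplicity

/-! ### The ideal of a parametrized curve and the reduction of a birational parametrization. -/

section Kernel

variable {K : Type*} [Field K] {σ : Type*}

theorem IsHomogeneous.bind₁_mul {q : MvPolynomial σ K} {n : ℕ} (hq : q.IsHomogeneous n)
    (g : MvPolynomial (Fin 2) K) (f : σ → MvPolynomial (Fin 2) K) :
    bind₁ (fun u => g * f u) q = g ^ n * bind₁ f q :=
  IsHomogeneous.aeval_smul hq g f

/-- Substituting forms of degree `d` multiplies degrees by `d`, and `d ≠ 0` keeps different
components apart. So the kernel is homogeneous and can be studied one degree at a time. -/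
theorem bind₁_homogeneousComponent {φ : σ → MvPolynomial (Fin 2) K} {d : ℕ} (hd : d ≠ 0)
    (hφ : ∀ u, (φ u).IsHomogeneous d) (n : ℕ) (q : MvPolynomial σ K) :
    bind₁ φ (homogeneousComponent n q) = homogeneousComponent (d * n) (bind₁ φ q) := by
  conv_rhs => rw [← sum_homogeneousComponent q, map_sum, map_sum]
  have h : ∀ i, homogeneousComponent (d * n) (bind₁ φ (homogeneousComponent i q)) =
      if i = n then bind₁ φ (homogeneousComponent n q) else 0 := by
    intro i
    have := (homogeneousComponent_isHomogeneous i q).aeval φ hφ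
    rw [homogeneousComponent_of_mem (p := bind₁ φ (homogeneousComponent i q)) (n := d * i) this]
    by_cases hi : i = n
    · simp [hi]
    · rw [if_neg (fun h => hi (Nat.eq_of_mul_eq_mul_left (Nat.pos_of_ne_zero hd) h).symm),
        if_neg hi]
  simp only [h, Finset.sum_ite_eq', Finset.mem_range]
  split_ifs with hn
  · rfl
  · rw [homogeneousComponent_eq_zero _ _ (by omega), map_zero]

theorem bind₁_homogeneousComponent_eq_zero {φ : σ → MvPolynomial (Fin 2) K} {d : ℕ} (hd : d ≠ 0)
    (hφ : ∀ u, (φ u).IsHomogeneous d) {q : MvPolynomial σ K} (hq : bind₁ φ q = 0) (n : ℕ) :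
    bind₁ φ (homogeneousComponent n q) = 0 := by
  rw [bind₁_homogeneousComponent hd hφ, hq, map_zero]

theorem mem_of_homogeneousComponent_mem {I : Ideal (MvPolynomial σ K)} {q : MvPolynomial σ K}
    (h : ∀ n, homogeneousComponent n q ∈ I) : q ∈ I := by
  rw [← sum_homogeneousComponent q]
  exact I.sum_mem fun n _ => h n

/-- The ideal of the curve parametrized by the forms `φ u`. -/
def paramIdeal (φ : σ → MvPolynomial (Fin 2) K) : Ideal (MvPolynomial σ K) :=
  RingHom.ker (bind₁ φ)

theorem mem_paramIdeal {φ : σ → MvPolynomial (Fin 2) K} {q : MvPolynomial σ K} :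
    q ∈ paramIdeal φ ↔ bind₁ φ q = 0 := Iff.rfl

/-- A rational inverse `G` of the parametrization of a curve with ideal `I` by the forms
`g * ψ u`. -/
structure IsRationalInverse (I : Ideal (MvPolynomial σ K)) (g : MvPolynomial (Fin 2) K)
    (ψ : σ → MvPolynomial (Fin 2) K) (b : ℕ) (G : Fin 2 → MvPolynomial σ K)
    (h : MvPolynomial σ K) : Prop where
  isHomogeneous : ∀ j, (G j).IsHomogeneous b
  notMem : h ∉ I
  left_inv : ∃ H : MvPolynomial (Fin 2) K, H ≠ 0 ∧ ∀ j, bind₁ ψ (G j) = H * X j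
  right_inv : ∀ u, bind₁ G (g * ψ u) - h * X u ∈ I

/-- The hypotheses say that the identity of the line is a constant map. The lemma excludes
parametrizations that are zero or constant. -/
theorem not_exists_mul_X_eq_mul_C (H : MvPolynomial (Fin 2) K) (hH : H ≠ 0)
    (g : MvPolynomial (Fin 2) K) (hg : g ≠ 0) (c : Fin 2 → K)
    (h : ∀ j, g * C (c j) = H * X j) : False := by
  have h1 : C (c 0) * X 1 = (C (c 1) * X 0 : MvPolynomial (Fin 2) K) := by
    apply mul_left_cancel₀ hg
    linear_combination X 1 * h 0 - X 0 * h 1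
  have h2 := congrArg (eval ![0, 1]) h1
  simp only [map_mul, eval_C, eval_X, Matrix.cons_val_one, Matrix.cons_val_zero, mul_one,
    mul_zero] at h2
  have h3 := h 0
  rw [h2, C_0, mul_zero] at h3
  exact mul_ne_zero hH (X_ne_zero 0) h3.symm

theorem bind₁_comp {ρ : Type*} (φ : σ → MvPolynomial (Fin 2) K) (G : ρ → MvPolynomial σ K)
    (q : MvPolynomial ρ K) : bind₁ φ (bind₁ G q) = bind₁ (fun j => bind₁ φ (G j)) q :=
  bind₁_bind₁ G φ q

theorem exists_hasNoCommonZero_of_isBirationalToLine {Z : Set (ℙ K (σ → K))}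
    (hprime : (projIdeal Z).IsPrime) (h : IsBirationalToLine Z) :
    ∃ (m e : ℕ) (g : MvPolynomial (Fin 2) K) (ψ : σ → MvPolynomial (Fin 2) K) (b : ℕ)
      (G : Fin 2 → MvPolynomial σ K) (h : MvPolynomial σ K),
      e ≠ 0 ∧ g.IsHomogeneous m ∧ g ≠ 0 ∧ (∀ u, (ψ u).IsHomogeneous e) ∧ HasNoCommonZero ψ ∧
      projIdeal Z = paramIdeal ψ ∧ IsRationalInverse (paramIdeal ψ) g ψ b G h := by
  obtain ⟨a, b, F, G, hF, hG, hFZ, ⟨H, hH, hGF⟩, h, hh, hFG⟩ := h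
  have hF0 : ∃ u, F u ≠ 0 := by
    by_contra! hF0
    refine not_exists_mul_X_eq_mul_C H hH 1 one_ne_zero (fun j => eval 0 (G j)) fun j => ?_
    rw [← hGF, one_mul]
    have : F = fun u => algebraMap K (MvPolynomial (Fin 2) K) ((0 : σ → K) u) := by
      ext1 u
      simp [hF0]
    rw [this]
    exact (aeval_algebraMap_apply (MvPolynomial (Fin 2) K) (0 : σ → K) (G j)).symm
  obtain ⟨m, e, g, ψ, hg, hg0, hψ, hψ0, hgψ⟩ := exists_eq_mul_hasNoCommonZero hF hF0
  obtain rfl : F = fun u => g * ψ u := funext hgψ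
  have he : e ≠ 0 := by
    rintro rfl
    choose c hc using fun u => IsHomogeneous.exists_eq_C (hψ u)
    refine not_exists_mul_X_eq_mul_C H hH (g ^ b) (pow_ne_zero _ hg0)
      (fun j => eval c (G j)) fun j => ?_
    rw [← hGF, IsHomogeneous.bind₁_mul (hG j)]
    obtain rfl : ψ = fun u => C (c u) := funext hc
    congr 1
    exact (aeval_algebraMap_apply (MvPolynomial (Fin 2) K) c (G j)).symm
  have hI : projIdeal Z = paramIdeal ψ := by
    ext q
    constructor
    · intro hq
      refine mem_of_homogeneousComponent_mem fun n => ?_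
      have hme : m + e ≠ 0 := by omega
      have h1 := bind₁_homogeneousComponent_eq_zero hme (fun u => hg.mul (hψ u)) (hFZ q hq) n
      rw [IsHomogeneous.bind₁_mul (homogeneousComponent_isHomogeneous n q)] at h1
      exact (mul_eq_zero.1 h1).resolve_left (pow_ne_zero _ hg0)
    · intro hq
      refine mem_of_homogeneousComponent_mem fun n => ?_
      have hn := homogeneousComponent_isHomogeneous n q
      set r := homogeneousComponent n q
      have h1 : bind₁ (fun u => g * ψ u) r = 0 := by
        rw [IsHomogeneous.bind₁_mul hn, bind₁_homogeneousComponent_eq_zero he hψ hq n, mul_zero]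
      -- Modulo the ideal of the curve, `h * X u` is `F u` composed with `G`. Hence `h ^ n * r` is
      -- the pullback by `G` of `r` evaluated on `F`, which vanishes; since the ideal is prime and
      -- omits `h`, it contains `r`.
      have h2 : Ideal.Quotient.mk (projIdeal Z) (h ^ n * r) = 0 := by
        have h3 : bind₁ (fun u => h * X u) r = h ^ n * r := by
          have := IsHomogeneous.aeval_smul hn h (X : σ → MvPolynomial σ K)
          rwa [aeval_X_left_apply] at this
        have h4 : (Ideal.Quotient.mkₐ K (projIdeal Z)).comp (bind₁ fun u => h * X u) =
            (Ideal.Quotient.mkₐ K (projIdeal Z)).comp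
              ((bind₁ G).comp (bind₁ fun u => g * ψ u)) := by
          ext u
          simp only [AlgHom.comp_apply, bind₁_X_right, Ideal.Quotient.mkₐ_eq_mk]
          exact (Ideal.Quotient.mk_eq_mk_iff_sub_mem _ _).2 (hFG u) |>.symm
        have h5 := DFunLike.congr_fun h4 r
        simp only [AlgHom.comp_apply, h1, map_zero, h3] at h5
        exact h5
      rw [Ideal.Quotient.eq_zero_iff_mem] at h2
      exact (hprime.mem_or_mem h2).resolve_left fun h' => hh (hprime.mem_of_pow_mem n h')
  refine ⟨m, e, g, ψ, b, G, h, he, hg, hg0, hψ, hψ0, hI, hG, hI ▸ hh, ?_, hI ▸ hFG⟩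
  have hj := fun j => hGF j
  simp only [IsHomogeneous.bind₁_mul (hG _)] at hj
  -- The relations in `hj` still carry the factor `g ^ b`. Eliminating `H` removes it, and
  -- divisibility by `X 0` then yields the new multiplier `H'` for `ψ` itself.
  have hX : X 1 * bind₁ ψ (G 0) = X 0 * bind₁ ψ (G 1) := by
    apply mul_left_cancel₀ (pow_ne_zero b hg0)
    linear_combination X 1 * hj 0 - X 0 * hj 1
  have hdvd : (X 0 : MvPolynomial (Fin 2) K) ∣ X 1 * bind₁ ψ (G 0) := hX ▸ dvd_mul_right _ _
  obtain ⟨H', hH'⟩ := ((X_prime (R := K)).dvd_or_dvd hdvd).resolve_left fun ⟨r, hr⟩ => by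
    have := congrArg (eval ![0, 1]) hr
    simp at this
  refine ⟨H', ?_, fun j => ?_⟩
  · rintro rfl
    have := hj 0
    rw [hH', mul_zero, mul_zero] at this
    exact mul_ne_zero hH (X_ne_zero 0) this.symm
  · fin_cases j
    · exact hH'.trans (mul_comm _ _)
    · apply mul_left_cancel₀ (X_ne_zero (R := K) (0 : Fin 2))
      simp only [Fin.mk_one]
      rw [← hX, hH']
      ring

end Kernel

/-! ### Parametrizations of the same degree differ by an automorphism of the line. -/

section Reparametrization

variable {K : Type*} [Field K] [IsAlgClosed K] {σ : Type*}

/-- A parametrization of a rational curve that has the same degree as a birational one differs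
from it by a linear automorphism of the line. -/
theorem exists_eq_C_mul_substitute {I : Ideal (MvPolynomial σ K)} {m d b : ℕ}
    {g : MvPolynomial (Fin 2) K} {ψ φ : σ → MvPolynomial (Fin 2) K} {G : Fin 2 → MvPolynomial σ K}
    {h : MvPolynomial σ K} (hd : d ≠ 0) (hg : g.IsHomogeneous m)
    (hψ : ∀ u, (ψ u).IsHomogeneous d) (hψ0 : HasNoCommonZero ψ) (hinv : IsRationalInverse I g ψ b G h)
    (hφ : ∀ u, (φ u).IsHomogeneous d) (hφ0 : HasNoCommonZero φ) (hI : paramIdeal φ = I) :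
    ∃ (γ : (Fin 2 → K) ≃ₗ[K] (Fin 2 → K)) (c : K), c ≠ 0 ∧
      ∀ u, φ u = C c * substitute γ (ψ u) := by
  -- This is `right_inv` pulled back along `φ`, allowed because `I` is the kernel of `bind₁ φ`.
  have hrel : ∀ u, bind₁ (fun j => bind₁ φ (G j)) (g * ψ u) = bind₁ φ h * φ u := by
    intro u
    have := hinv.right_inv u
    rw [← hI, mem_paramIdeal, map_sub, sub_eq_zero, map_mul (bind₁ φ), bind₁_X_right,
      bind₁_comp] at this
    exact this
  have hh : bind₁ φ h ≠ 0 := fun h0 => hinv.notMem (hI ▸ mem_paramIdeal.2 h0)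
  obtain ⟨w, hw⟩ := hφ0.exists_ne_zero
  have hghom : ∀ u, (g * ψ u).IsHomogeneous (m + d) := fun u => hg.mul (hψ u)
  have hGne : ∃ j, bind₁ φ (G j) ≠ 0 := by
    by_contra! hG0
    have := hrel w
    rw [show (fun j => bind₁ φ (G j)) = fun j => (0 : MvPolynomial (Fin 2) K) * X j from
      funext fun j => by rw [hG0, zero_mul], IsHomogeneous.bind₁_mul (hghom w),
      zero_pow (by omega), zero_mul] at this
    exact mul_ne_zero hh hw this.symm
  -- After removal of the common factor `q`, the pair `a` is the composite of `φ` with the rational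
  -- inverse: a morphism of degree `r` from the line to itself.
  obtain ⟨k, r, q, a, -, hq0, ha, ha0, hqa⟩ := exists_eq_mul_hasNoCommonZero
    (fun j => (hinv.isHomogeneous j).aeval φ hφ) hGne
  have hrel' : ∀ u, (q ^ (m + d) * bind₁ a g) * bind₁ a (ψ u) = bind₁ φ h * φ u := by
    intro u
    rw [← hrel, show (fun j => bind₁ φ (G j)) = fun j => q * a j from funext hqa,
      IsHomogeneous.bind₁_mul (hghom u), map_mul, mul_assoc]
  have hθhom : ∀ u, (bind₁ a (ψ u)).IsHomogeneous (r * d) := fun u => (hψ u).aeval a ha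
  have hθ0 : HasNoCommonZero fun u => bind₁ a (ψ u) := by
    intro y hy
    obtain ⟨j, hj⟩ := ha0 y hy
    obtain ⟨u, hu⟩ := hψ0 (fun j => eval y (a j)) fun h0 => hj (congrFun h0 j)
    refine ⟨u, ?_⟩
    have : (aeval y).comp (bind₁ a) = aeval (R := K) fun j => eval y (a j) := by
      ext j
      rw [AlgHom.comp_apply, bind₁_X_right, aeval_X, aeval_eq_eval]
    have h2 := DFunLike.congr_fun this (ψ u)
    rw [AlgHom.comp_apply, aeval_eq_eval, aeval_eq_eval] at h2
    rwa [h2]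
  have hne := hrel' w ▸ mul_ne_zero hh hw
  have hθw : bind₁ a (ψ w) ≠ 0 := right_ne_zero_of_mul hne
  -- The multipliers in `hrel'` need not be homogeneous, since `h` is arbitrary. Eliminating them
  -- between the relations for `u` and `w` leaves the homogeneous multipliers `bind₁ a (ψ w)` and `φ
  -- w`.
  obtain ⟨c, hc, hcφ⟩ := exists_eq_C_mul hφ0 hθ0 (hθhom w) (hφ w) hθw hw fun u => by
    apply mul_left_cancel₀ (mul_ne_zero hh (left_ne_zero_of_mul hne))
    linear_combination (-q ^ (m + d) * bind₁ a g * bind₁ a (ψ w)) * hrel' u +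
      (q ^ (m + d) * bind₁ a g * bind₁ a (ψ u)) * hrel' w
  have hr : r = 1 := by
    have h1 : (φ w).IsHomogeneous (r * d) := by
      rw [hcφ w]
      exact (hθhom w).C_mul c
    exact Nat.eq_of_mul_eq_mul_right (Nat.pos_of_ne_zero hd)
      ((h1.inj_right (hφ w) hw).trans (one_mul d).symm)
  subst hr
  obtain ⟨γ, hγ⟩ := exists_linearEquiv_of_hasNoCommonZero ha ha0
  exact ⟨γ, c, hc, fun u => by rw [hcφ, hγ]⟩

end Reparametrization

/-! ### The Hilbert function of a parametrized curve and its degree. -/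

section Degree

variable {K : Type*} [Field K] {σ : Type*}

theorem finrank_homogeneousSubmodule_fin_two (n : ℕ) :
    Module.finrank K (homogeneousSubmodule (Fin 2) K n) = n + 1 := by
  let e : {s : Fin 2 →₀ ℕ | s.degree = n} ≃ Fin (n + 1) :=
    { toFun := fun s => ⟨s.1 0, by
        have := s.2
        rw [Set.mem_ofPred_eq, Finsupp.degree_eq_sum, Fin.sum_univ_two] at this
        omega⟩
      invFun := fun i => ⟨Finsupp.equivFunOnFinite.symm ![i, n - i], by
        rw [Set.mem_ofPred_eq, Finsupp.degree_eq_sum, Fin.sum_univ_two]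
        simpa using by omega⟩
      left_inv := fun s => by
        have := s.2
        rw [Set.mem_ofPred_eq, Finsupp.degree_eq_sum, Fin.sum_univ_two] at this
        ext i
        fin_cases i
        · simp
        · simpa using by omega
      right_inv := fun i => by
        ext
        simp }
  rw [homogeneousSubmodule_eq_finsupp_supported,
    ((AddMonoidAlgebra.supportedEquivFinsupp _).trans
      (Finsupp.domLCongr e)).finrank_eq]
  simp

instance (n : ℕ) : Module.Finite K (homogeneousSubmodule (Fin 2) K n) :=
  Module.finite_of_finrank_pos (by rw [finrank_homogeneousSubmodule_fin_two]; omega)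

/-- The forms of degree `d * m` that are polynomials of degree `m` in the forms `φ u`. -/
def paramSubmodule (φ : σ → MvPolynomial (Fin 2) K) (m : ℕ) :
    Submodule K (MvPolynomial (Fin 2) K) :=
  (homogeneousSubmodule σ K m).map (bind₁ φ).toLinearMap

theorem hilbertFunction_eq_finrank {Z : Set (ℙ K (σ → K))} {φ : σ → MvPolynomial (Fin 2) K}
    (h : projIdeal Z = paramIdeal φ) (m : ℕ) :
    hilbertFunction Z m = Module.finrank K (paramSubmodule φ m) := by
  unfold hilbertFunction
  have hker : ∀ q ∈ projIdeal Z, bind₁ φ q = 0 := fun q hq => by rwa [h] at hq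
  let f := Ideal.Quotient.liftₐ (projIdeal Z) (bind₁ φ) hker
  have hinj : Function.Injective f.toLinearMap :=
    RingHom.lift_injective_of_ker_le_ideal (projIdeal Z) hker h.ge
  have hmap : paramSubmodule φ m = ((homogeneousSubmodule σ K m).map
      (Ideal.Quotient.mkₐ K (projIdeal Z)).toLinearMap).map f.toLinearMap := by
    rw [← Submodule.map_comp]
    rfl
  rw [hmap]
  exact (Submodule.equivMapOfInjective _ hinj _).finrank_eq

theorem paramSubmodule_le {φ : σ → MvPolynomial (Fin 2) K} {d : ℕ}
    (hφ : ∀ u, (φ u).IsHomogeneous d) (m : ℕ) :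
    paramSubmodule φ m ≤ homogeneousSubmodule (Fin 2) K (d * m) := by
  rintro _ ⟨q, hq, rfl⟩
  exact IsHomogeneous.aeval hq φ hφ

theorem mul_mem_paramSubmodule {φ : σ → MvPolynomial (Fin 2) K} {m n : ℕ}
    {p q : MvPolynomial (Fin 2) K} (hp : p ∈ paramSubmodule φ m) (hq : q ∈ paramSubmodule φ n) :
    p * q ∈ paramSubmodule φ (m + n) := by
  obtain ⟨a, ha, rfl⟩ := hp
  obtain ⟨b, hb, rfl⟩ := hq
  exact ⟨a * b, IsHomogeneous.mul ha hb, map_mul (bind₁ φ) a b⟩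

theorem mem_paramSubmodule_one (φ : σ → MvPolynomial (Fin 2) K) (u : σ) :
    φ u ∈ paramSubmodule φ 1 :=
  ⟨X u, isHomogeneous_X K u, bind₁_X_right φ u⟩

/-- If `H * X j` is the value of a form `G j` of degree `b` on `φ`, then `H ^ n * p` is the value on
`φ` of `p` composed with `G`. -/
theorem prod_X_pow_mem {b : ℕ} {φ : σ → MvPolynomial (Fin 2) K} {H : MvPolynomial (Fin 2) K}
    (h : ∀ j, H * X j ∈ paramSubmodule φ b) (n : ℕ) {p : MvPolynomial (Fin 2) K}
    (hp : p.IsHomogeneous n) : H ^ n * p ∈ paramSubmodule φ (b * n) := by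
  have h1 : (bind₁ fun j => H * X j) p = H ^ n * p := by
    have := IsHomogeneous.aeval_smul hp H (X : Fin 2 → MvPolynomial (Fin 2) K)
    rwa [aeval_X_left_apply] at this
  rw [← h1]
  choose G hG hGH using h
  have h2 : (bind₁ fun j => H * X j) p = bind₁ φ (bind₁ G p) := by
    rw [bind₁_comp]
    congr 2
    funext j
    exact (hGH j).symm
  rw [h2]
  exact ⟨bind₁ G p, hp.aeval G hG, rfl⟩

theorem exists_forall_eq_sum [IsAlgClosed K] [Fintype σ] {φ : σ → MvPolynomial (Fin 2) K} {d : ℕ}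
    (hφ : ∀ u, (φ u).IsHomogeneous d) (hφ0 : HasNoCommonZero φ) :
    ∃ N : ℕ, ∀ n, N ≤ n → ∀ p : MvPolynomial (Fin 2) K, p.IsHomogeneous (d + n) →
      ∃ r : σ → MvPolynomial (Fin 2) K, (∀ u, (r u).IsHomogeneous n) ∧ p = ∑ u, φ u * r u := by
  obtain ⟨k, hk⟩ := exists_X_pow_mem (Ideal.span (Set.range φ)) fun y hy => by
    obtain ⟨u, hu⟩ := hφ0 y hy
    exact ⟨φ u, Ideal.subset_span ⟨u, rfl⟩, hu⟩
  -- A monomial in two variables of degree at least `2 * k` has an exponent at least `k`, so it lies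
  -- in the ideal generated by the `φ u`.
  refine ⟨2 * k, fun n hn p hp => ?_⟩
  have hpI : p ∈ Ideal.span (Set.range φ) := by
    rw [p.as_sum]
    refine Ideal.sum_mem _ fun s hs => ?_
    have hs' := hp.degree_eq_sum_deg_support hs
    have hs2 : d + n = s 0 + s 1 := by
      rw [hs', ← Fin.sum_univ_two, ← Finsupp.degree_eq_sum, Finsupp.degree_apply]
    have hs3 : k ≤ s 0 ∨ k ≤ s 1 := by omega
    have hmem : ∀ j, k ≤ s j → monomial s (coeff s p) ∈ Ideal.span (Set.range φ) := by
      intro j hj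
      refine Ideal.mem_of_dvd _ ?_ (hk j)
      rw [X_pow_eq_monomial, monomial_dvd_monomial]
      exact ⟨Or.inr (Finsupp.single_le_iff.2 hj), one_dvd _⟩
    exact hs3.elim (hmem 0) (hmem 1)
  obtain ⟨c, hc⟩ := Ideal.mem_span_range_iff_exists_fun.1 hpI
  refine ⟨fun u => homogeneousComponent n (c u), fun u => homogeneousComponent_isHomogeneous _ _, ?_⟩
  rw [← homogeneousComponent_eq_self hp, ← hc, map_sum]
  refine Finset.sum_congr rfl fun u _ => ?_
  rw [mul_comm, homogeneousComponent_mul_of_isHomogeneous (hφ u)]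

/-- Forms of degree `N` are brought into the subalgebra generated by the `φ u` by the factor `H ^
N`. Higher degrees follow by splitting off one factor `φ u` at a time, without changing the
multiplier. Multiplication by this fixed `H'` bounds the Hilbert function below. -/
theorem exists_mul_mem_paramSubmodule [IsAlgClosed K] [Fintype σ]
    {φ : σ → MvPolynomial (Fin 2) K} {d b : ℕ} {H : MvPolynomial (Fin 2) K} (hH : H ≠ 0)
    (hφ : ∀ u, (φ u).IsHomogeneous d) (hφ0 : HasNoCommonZero φ)
    (h : ∀ j, H * X j ∈ paramSubmodule φ b) :
    ∃ (N D : ℕ) (H' : MvPolynomial (Fin 2) K), H' ≠ 0 ∧ ∀ m, ∀ p : MvPolynomial (Fin 2) K,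
      p.IsHomogeneous (d * m + N) → H' * p ∈ paramSubmodule φ (m + D) := by
  obtain ⟨N, hN⟩ := exists_forall_eq_sum hφ hφ0
  refine ⟨N, b * N, H ^ N, pow_ne_zero _ hH, fun m => ?_⟩
  induction m with
  | zero =>
    intro p hp
    rw [zero_add]
    exact prod_X_pow_mem h N (by simpa using hp)
  | succ m ih =>
    intro p hp
    obtain ⟨r, hr, rfl⟩ := hN (d * m + N) (by omega) p (by convert hp using 1; ring)
    rw [Finset.mul_sum]
    refine Submodule.sum_mem _ fun u _ => ?_
    rw [mul_left_comm, show m + 1 + b * N = 1 + (m + b * N) by ring]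
    exact mul_mem_paramSubmodule (mem_paramSubmodule_one φ u) (ih _ (hr u))

theorem le_of_eventually_mul_add_le {d e : ℕ} {b c : ℚ}
    (h : ∀ᶠ m : ℕ in Filter.atTop, (d : ℚ) * m + b ≤ e * m + c) : d ≤ e := by
  by_contra! hlt
  obtain ⟨m, hm, hm2⟩ := (h.and (Filter.eventually_gt_atTop ⌈c - b⌉₊)).exists
  have h1 : (e : ℚ) + 1 ≤ d := by exact_mod_cast hlt
  have h2 : c - b < m := (Nat.le_ceil _).trans_lt (by exact_mod_cast hm2)
  nlinarith

/-- A birational parametrization without common zeros has the degree of the curve. -/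
theorem degree_eq_of_isRationalInverse [IsAlgClosed K] [Fintype σ] {Z : Set (ℙ K (σ → K))}
    {d e b : ℕ} {g : MvPolynomial (Fin 2) K} {ψ : σ → MvPolynomial (Fin 2) K}
    {G : Fin 2 → MvPolynomial σ K} {h : MvPolynomial σ K} (hZ : projIdeal Z = paramIdeal ψ)
    (hψ : ∀ u, (ψ u).IsHomogeneous e) (hψ0 : HasNoCommonZero ψ)
    (hinv : IsRationalInverse (paramIdeal ψ) g ψ b G h) (hd : IsOneDimensionalOfDegree Z d) :
    e = d := by
  obtain ⟨P, hP, hP1, hPd⟩ := hd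
  have hPeval : ∀ x : ℚ, P.eval x = d * x + P.coeff 0 := by
    intro x
    rw [Polynomial.eval_eq_sum_range, hP1, Finset.sum_range_succ, Finset.sum_range_one,
      ← hPd, Polynomial.leadingCoeff, hP1]
    ring
  have hP' : ∀ᶠ m : ℕ in Filter.atTop,
      (Module.finrank K (paramSubmodule ψ m) : ℚ) = d * m + P.coeff 0 := by
    filter_upwards [hP] with m hm
    rw [← hPeval, ← hm, hilbertFunction_eq_finrank hZ]
  apply le_antisymm
  -- Lower bound: multiplication by `H'` embeds the `e * m + N + 1` dimensional space of forms into
  -- degree `m + D` of the coordinate ring.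
  · obtain ⟨H, hH, hGH⟩ := hinv.left_inv
    obtain ⟨N, D, H', hH', hm⟩ := exists_mul_mem_paramSubmodule hH hψ hψ0
      fun j => ⟨G j, hinv.isHomogeneous j, hGH j⟩
    refine le_of_eventually_mul_add_le (b := 0) (c := d * D + P.coeff 0) ?_
    filter_upwards [(Filter.tendsto_add_atTop_nat D).eventually hP'] with m hPm
    have hle : e * m + N + 1 ≤ Module.finrank K (paramSubmodule ψ (m + D)) := by
      have : Module.Finite K (paramSubmodule ψ (m + D)) :=
        Submodule.finiteDimensional_of_le (paramSubmodule_le hψ _)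
      rw [← finrank_homogeneousSubmodule_fin_two (K := K)]
      refine LinearMap.finrank_le_finrank_of_injective
        (f := ((LinearMap.mulLeft K H').restrict fun p hp => hm m p hp)) ?_
      intro p q hpq
      exact Subtype.ext (mul_left_cancel₀ hH' (congrArg Subtype.val hpq))
    have hle' : ((e * m + N + 1 : ℕ) : ℚ) ≤ Module.finrank K (paramSubmodule ψ (m + D)) := by
      exact_mod_cast hle
    rw [hPm] at hle'
    push_cast at hle'
    have : (0 : ℚ) ≤ N := Nat.cast_nonneg N
    linarith
  -- Upper bound: the coordinate ring in degree `m` consists of forms of degree `e * m`.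
  · refine le_of_eventually_mul_add_le (b := P.coeff 0) (c := 1) ?_
    filter_upwards [hP'] with m hPm
    rw [← hPm]
    have := Submodule.finrank_mono (paramSubmodule_le hψ m)
    rw [finrank_homogeneousSubmodule_fin_two] at this
    exact_mod_cast this

end Degree

/-! ### Vanishing ideals and closures of parametrized curves. -/

section Closure

variable {K : Type*} [Field K] {σ : Type*}

theorem mem_projIdeal {S : Set (ℙ K (σ → K))} {q : MvPolynomial σ K} :
    q ∈ projIdeal S ↔ ∀ (v : σ → K) (hv : v ≠ 0), Projectivization.mk K v hv ∈ S → eval v q = 0 := by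
  rw [projIdeal, mem_vanishingIdeal_iff]
  exact ⟨fun h v hv hS => h v ⟨hv, hS⟩, fun h v ⟨hv, hS⟩ => h v hv hS⟩

theorem mem_projZeros {I : Ideal (MvPolynomial σ K)} {x : ℙ K (σ → K)} :
    x ∈ projZeros I ↔ ∀ (v : σ → K) (hv : v ≠ 0), Projectivization.mk K v hv = x →
      ∀ q ∈ I, eval v q = 0 := Iff.rfl

theorem projIdeal_projZeros_projIdeal (S : Set (ℙ K (σ → K))) :
    projIdeal (projZeros (projIdeal S)) = projIdeal S := by
  ext q
  simp only [mem_projIdeal (S := projZeros _), mem_projZeros]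
  refine ⟨fun h => mem_projIdeal.2 fun v hv hS => h v hv fun v' hv' hv'' q' hq' => ?_,
    fun hq v hv h => h v hv rfl q hq⟩
  exact mem_projIdeal.1 hq' v' hv' (hv'' ▸ hS)

theorem le_projIdeal_of_subset_projZeros {S : Set (ℙ K (σ → K))} {I : Ideal (MvPolynomial σ K)}
    (h : S ⊆ projZeros I) : I ≤ projIdeal S :=
  fun _ hq => mem_projIdeal.2 fun v hv hS => h hS v hv rfl _ hq

theorem eval_bind₁ {ρ : Type*} (y : ρ → K) (φ : σ → MvPolynomial ρ K) (q : MvPolynomial σ K) :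
    eval y (bind₁ φ q) = eval (fun u => eval y (φ u)) q := by
  have : (aeval y).comp (bind₁ φ) = aeval (R := K) fun u => eval y (φ u) := by
    ext j
    rw [AlgHom.comp_apply, bind₁_X_right, aeval_X, aeval_eq_eval]
  exact DFunLike.congr_fun this q

/-- The image of the rational map from the line given by the binary forms `φ u`. -/
def paramImage (φ : σ → MvPolynomial (Fin 2) K) : Set (ℙ K (σ → K)) :=
  {x | ∃ y : Fin 2 → K, y ≠ 0 ∧ ∃ h : (fun u => eval y (φ u)) ≠ 0, x = Projectivization.mk K _ h}

theorem projIdeal_paramImage [IsAlgClosed K] {φ : σ → MvPolynomial (Fin 2) K} {d : ℕ} (hd : d ≠ 0)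
    (hφ : ∀ u, (φ u).IsHomogeneous d) (hφ0 : ∃ u, φ u ≠ 0) :
    projIdeal (paramImage φ) = paramIdeal φ := by
  ext q
  rw [mem_projIdeal, mem_paramIdeal]
  constructor
  · intro h
    obtain ⟨w, hw⟩ := hφ0
    -- The factor `φ w` takes care of the points where the rational map is undefined; `d ≠ 0` makes
    -- it vanish at the origin too.
    refine (mul_eq_zero.1 (MvPolynomial.funext fun y => ?_ : bind₁ φ q * φ w = 0)).resolve_right hw
    rw [map_mul, map_zero]
    by_cases hy : eval y (φ w) = 0
    · rw [hy, mul_zero]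
    · rw [eval_bind₁, h _ (fun h0 => hy (congrFun h0 w)) ⟨y, ?_, fun h0 => hy (congrFun h0 w), rfl⟩,
        zero_mul]
      rintro rfl
      have := IsHomogeneous.eval_smul (hφ w) 0 0
      rw [zero_pow hd, zero_mul, smul_zero] at this
      exact hy this
  · rintro hq v hv ⟨y, hy, h, hvy⟩
    rw [Projectivization.mk_eq_mk_iff'] at hvy
    obtain ⟨c, rfl⟩ := hvy
    -- Every representative of an image point is itself a value of `φ`: a `d`-th root of the scalar
    -- is moved into the argument.
    obtain ⟨a, rfl⟩ := IsAlgClosed.exists_pow_nat_eq c (Nat.pos_of_ne_zero hd)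
    have : a ^ d • (fun u => eval y (φ u)) = fun u => eval (a • y) (φ u) := by
      ext u
      rw [IsHomogeneous.eval_smul (hφ u), Pi.smul_apply, smul_eq_mul]
    rw [this, ← eval_bind₁, hq, map_zero]

theorem projIdeal_projZeros_paramIdeal [IsAlgClosed K] {φ : σ → MvPolynomial (Fin 2) K} {d : ℕ}
    (hd : d ≠ 0) (hφ : ∀ u, (φ u).IsHomogeneous d) (hφ0 : ∃ u, φ u ≠ 0) :
    projIdeal (projZeros (paramIdeal φ)) = paramIdeal φ := by
  rw [← projIdeal_paramImage hd hφ hφ0, projIdeal_projZeros_projIdeal]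

/-- The scalar acts on the image of the degree `n` component by `c ^ n`, and the kernel is
homogeneous. -/
theorem paramIdeal_const_mul {φ : σ → MvPolynomial (Fin 2) K} {d : ℕ} (hd : d ≠ 0)
    (hφ : ∀ u, (φ u).IsHomogeneous d) {c : K} (hc : c ≠ 0) :
    paramIdeal (fun u => C c * φ u) = paramIdeal φ := by
  have key : ∀ (c : K) (ψ : σ → MvPolynomial (Fin 2) K), (∀ u, (ψ u).IsHomogeneous d) →
      paramIdeal ψ ≤ paramIdeal fun u => C c * ψ u := by
    intro c ψ hψ q hq
    refine mem_of_homogeneousComponent_mem fun n => ?_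
    rw [mem_paramIdeal, IsHomogeneous.bind₁_mul (homogeneousComponent_isHomogeneous n q),
      bind₁_homogeneousComponent_eq_zero hd hψ hq, mul_zero]
  refine le_antisymm ?_ (key c φ hφ)
  have := key c⁻¹ (fun u => C c * φ u) fun u => (hφ u).C_mul c
  simpa only [← mul_assoc, ← C_mul, inv_mul_cancel₀ hc, C_1, one_mul] using this

theorem paramIdeal_substitute [Infinite K] (g : (Fin 2 → K) ≃ₗ[K] (Fin 2 → K))
    (φ : σ → MvPolynomial (Fin 2) K) :
    paramIdeal (fun u => substitute g (φ u)) = paramIdeal φ := by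
  ext q
  have : bind₁ (fun u => substitute g (φ u)) q = substitute g (bind₁ φ q) := by
    have : bind₁ (fun u => substitute g (φ u)) = (substitute g).comp (bind₁ φ) := by
      ext u
      simp
    rw [this, AlgHom.comp_apply]
  rw [mem_paramIdeal, mem_paramIdeal, this, map_eq_zero_iff _ (substitute_injective g)]

end Closure

/-! ### The torus action on parametrized curves. -/

section Translate

variable {K : Type*} [Field K] {ι : Type*}

theorem rescale_mk (c : ι → Kˣ) {v : ι → K} (hv : v ≠ 0) (hv' : (fun u => (c u : K) * v u) ≠ 0) :
    rescale c (Projectivization.mk K v hv) = Projectivization.mk K (fun u => (c u : K) * v u) hv' := by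
  rw [rescale, Projectivization.map_mk]
  rfl

theorem units_mul_ne_zero (c : ι → Kˣ) {v : ι → K} (hv : v ≠ 0) :
    (fun u => (c u : K) * v u) ≠ 0 := by
  intro h
  refine hv (funext fun u => ?_)
  exact (mul_eq_zero.1 (congrFun h u)).resolve_left (c u).ne_zero

theorem rescale_inv_rescale (c : ι → Kˣ) (x : ℙ K (ι → K)) : rescale c⁻¹ (rescale c x) = x := by
  induction x using Projectivization.ind with
  | h v hv =>
    rw [rescale_mk c hv (units_mul_ne_zero c hv), rescale_mk _ _ (units_mul_ne_zero _ _)]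
    · simp
    · exact units_mul_ne_zero c hv

theorem rescale_mem_projZeros (c : ι → Kˣ) {φ : ι → MvPolynomial (Fin 2) K} {x : ℙ K (ι → K)}
    (hx : x ∈ projZeros (paramIdeal φ)) :
    rescale c x ∈ projZeros (paramIdeal fun u => C (c u : K) * φ u) := by
  intro v hv hvx q hq
  have hx' : Projectivization.mk K _ (units_mul_ne_zero c⁻¹ hv) = x := by
    rw [← rescale_mk _ hv, hvx, rescale_inv_rescale]
  have := hx _ _ hx' (bind₁ (fun u => C (c u : K) * X u) q) (by
    rw [mem_paramIdeal, bind₁_bind₁]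
    simpa using! hq)
  rw [aeval_eq_eval] at this ⊢
  rw [eval_bind₁] at this
  simpa using this

theorem image_rescale_projZeros (c : ι → Kˣ) (φ : ι → MvPolynomial (Fin 2) K) :
    rescale c '' projZeros (paramIdeal φ) = projZeros (paramIdeal fun u => C (c u : K) * φ u) := by
  apply subset_antisymm
  · rintro _ ⟨x, hx, rfl⟩
    exact rescale_mem_projZeros c hx
  · intro y hy
    refine ⟨rescale c⁻¹ y, ?_, by simpa using rescale_inv_rescale c⁻¹ y⟩
    have := rescale_mem_projZeros c⁻¹ hy
    simpa [← mul_assoc, ← C_mul] using this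

variable {M : Type*} [AddCommGroup M] {A τ : Finset M}

theorem diff_add_diff (u v w : τ) : diff u v + diff v w = diff u w :=
  Subtype.ext (sub_add_sub_cancel _ _ _)

theorem torusScalars_of_mem (t : Torus K τ) (w : τ) (u : A) (h : (u : M) ∈ τ) :
    torusScalars A t w u = t (Multiplicative.ofAdd (diff ⟨u, h⟩ w)) := dif_pos h

theorem torusScalars_apply (hτA : τ ⊆ A) (t : Torus K τ) (w u : τ) :
    torusScalars A t w ⟨u, hτA u.2⟩ = t (Multiplicative.ofAdd (diff u w)) := dif_pos u.2

/-- `translate` is a union over all reference weights `v`. Replacing `v` by `w` changes the scalars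
on `τ` by the common factor `t (w - v)`, and the forms vanish off `τ`, so all members of the union
coincide. -/
theorem translate_projZeros {φ : A → MvPolynomial (Fin 2) K} {d : ℕ} (hd : d ≠ 0)
    (hφ : ∀ u, (φ u).IsHomogeneous d) (hτ : ∀ u : A, (u : M) ∉ τ → φ u = 0) (t : Torus K τ)
    (w : τ) : translate t (projZeros (paramIdeal φ)) =
      projZeros (paramIdeal fun u => C (torusScalars A t w u : K) * φ u) := by
  have h1 : translate t (projZeros (paramIdeal φ)) =
      ⋃ v : τ, rescale (torusScalars A t v) '' projZeros (paramIdeal φ) := by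
    ext y
    simp only [translate, Set.mem_iUnion, Set.mem_image]
    exact ⟨fun ⟨x, hx, v, h⟩ => ⟨v, x, hx, h.symm⟩, fun ⟨v, x, hx, h⟩ => ⟨x, hx, v, h.symm⟩⟩
  have h2 : ∀ v : τ, rescale (torusScalars A t v) '' projZeros (paramIdeal φ) =
      projZeros (paramIdeal fun u => C (torusScalars A t w u : K) * φ u) := by
    intro v
    rw [image_rescale_projZeros]
    congr 1
    rw [← paramIdeal_const_mul (φ := fun u => C (torusScalars A t w u : K) * φ u) hd
      (fun u => (hφ u).C_mul _)
      (t (Multiplicative.ofAdd (diff w v))).ne_zero]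
    congr 1
    ext1 u
    by_cases hu : (u : M) ∈ τ
    · rw [torusScalars_of_mem t v u hu, torusScalars_of_mem t w u hu, ← diff_add_diff (⟨u, hu⟩ : τ) w v,
        ofAdd_add, map_mul, Units.val_mul, C_mul]
      ring
    · rw [hτ u hu]
      simp
  have : Nonempty τ := ⟨w⟩
  rw [h1, Set.iUnion_congr h2, Set.iUnion_const]

end Translate

/-! ### Homomorphisms on the lattice of differences. -/

section Lattice

variable {M : Type*} [AddCommGroup M] {τ : Finset M} {B : Type*} [AddCommGroup B]

/-- A map on `τ` that respects all affine relations extends to the lattice of differences. -/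
theorem exists_addMonoidHom_diffLattice (b : τ → B)
    (h : ∀ α β : τ → ℕ, ∑ u, α u = ∑ u, β u → ∑ u, α u • (u : M) = ∑ u, β u • (u : M) →
      ∑ u, α u • b u = ∑ u, β u • b u) :
    ∃ L : diffLattice τ →+ B, ∀ u w : τ, L (diff u w) = b u - b w := by
  classical
  -- The graph of the desired homomorphism: integral affine combinations are written as differences
  -- of natural ones of equal total weight. It is single-valued by `h`.
  let R : M → B → Prop := fun m x => ∃ α β : τ → ℕ, ∑ u, α u = ∑ u, β u ∧
    m = ∑ u, α u • (u : M) - ∑ u, β u • (u : M) ∧ x = ∑ u, α u • b u - ∑ u, β u • b u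
  have hR0 : ∀ x, R 0 x → x = 0 := by
    rintro x ⟨α, β, h1, h2, rfl⟩
    rw [h α β h1 (sub_eq_zero.1 h2.symm), sub_self]
  have hadd : ∀ m m' x x', R m x → R m' x' → R (m + m') (x + x') := by
    rintro _ _ _ _ ⟨α, β, h1, rfl, rfl⟩ ⟨α', β', h1', rfl, rfl⟩
    refine ⟨α + α', β + β', ?_, ?_, ?_⟩
    · simp only [Pi.add_apply, Finset.sum_add_distrib, h1, h1']
    · simp only [Pi.add_apply, add_smul, Finset.sum_add_distrib]
      abel
    · simp only [Pi.add_apply, add_smul, Finset.sum_add_distrib]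
      abel
  have hneg : ∀ m x, R m x → R (-m) (-x) := by
    rintro _ _ ⟨α, β, h1, rfl, rfl⟩
    exact ⟨β, α, h1.symm, (neg_sub _ _), (neg_sub _ _)⟩
  have huniq : ∀ m x y, R m x → R m y → x = y := fun m x y hx hy => by
    have := hadd _ _ _ _ hx (hneg _ _ hy)
    rw [add_neg_cancel] at this
    exact add_neg_eq_zero.1 (hR0 _ this)
  have hdiff : ∀ u w : τ, R ((u : M) - w) (b u - b w) := by
    intro u w
    refine ⟨Pi.single u 1, Pi.single w 1, ?_, ?_, ?_⟩
    · simp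
    · simp [Pi.single_apply]
    · simp [Pi.single_apply]
  have hex : ∀ m : diffLattice τ, ∃ x, R m x := by
    rintro ⟨m, hm⟩
    induction hm using AddSubgroup.closure_induction with
    | mem m hm =>
      obtain ⟨u, hu, w, hw, rfl⟩ := hm
      exact ⟨_, hdiff ⟨u, hu⟩ ⟨w, hw⟩⟩
    | zero => exact ⟨0, 0, 0, rfl, by simp, by simp⟩
    | add m m' _ _ hm hm' =>
      obtain ⟨x, hx⟩ := hm
      obtain ⟨x', hx'⟩ := hm'
      exact ⟨_, hadd _ _ _ _ hx hx'⟩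
    | neg m _ hm =>
      obtain ⟨x, hx⟩ := hm
      exact ⟨_, hneg _ _ hx⟩
  choose L hL using hex
  refine ⟨AddMonoidHom.mk' L fun m m' => ?_, fun u w => ?_⟩
  · exact huniq _ _ _ (hL (m + m')) (hadd _ _ _ _ (hL m) (hL m'))
  · exact huniq _ _ _ (hL (diff u w)) (hdiff u w)

theorem torus_ext {K : Type*} [Field K] {t t' : Torus K τ} (w : τ)
    (h : ∀ u : τ, t (Multiplicative.ofAdd (diff u w)) = t' (Multiplicative.ofAdd (diff u w))) :
    t = t' := by
  have hd : ∀ u v : τ, t (Multiplicative.ofAdd (diff u v)) = t' (Multiplicative.ofAdd (diff u v)) := by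
    intro u v
    have h1 := congrArg (fun x => t (Multiplicative.ofAdd x)) (diff_add_diff u v w)
    have h2 := congrArg (fun x => t' (Multiplicative.ofAdd x)) (diff_add_diff u v w)
    simp only [ofAdd_add, map_mul, h u, h v] at h1 h2
    exact mul_right_cancel (h1.trans h2.symm)
  ext ⟨m, hm⟩
  congr 1
  change t (Multiplicative.ofAdd ⟨m, hm⟩) = t' (Multiplicative.ofAdd ⟨m, hm⟩)
  induction hm using AddSubgroup.closure_induction with
  | mem m hm =>
    obtain ⟨u, hu, w, hw, rfl⟩ := hm
    exact hd ⟨u, hu⟩ ⟨w, hw⟩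
  | zero => exact (map_one t).trans (map_one t').symm
  | add m m' h1 h2 hm hm' =>
    exact (map_mul t (.ofAdd ⟨m, h1⟩) (.ofAdd ⟨m', h2⟩)).trans
      ((congrArg₂ _ hm hm').trans (map_mul t' (.ofAdd ⟨m, h1⟩) (.ofAdd ⟨m', h2⟩)).symm)
  | neg m h1 hm =>
    exact (map_inv t (.ofAdd ⟨m, h1⟩)).trans
      ((congrArg _ hm).trans (map_inv t' (.ofAdd ⟨m, h1⟩)).symm)

end Lattice

/-! ### Equations of the toric variety. -/

section ToricIdeal

variable {K : Type*} [Field K] {M : Type*} [AddCommGroup M] {A τ : Finset M}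

theorem X_mem_toricIdeal {u : A} (hu : (u : M) ∉ τ) : X u ∈ toricIdeal K A τ := by
  rw [toricIdeal, RingHom.mem_ker, aeval_X, if_neg hu]

/-- Both monomials map to the same character of `M × ℤ`. Of the toric ideal, only these binomials
and the variables outside `τ` are needed. -/
theorem binomial_mem_toricIdeal (hτA : τ ⊆ A) {α β : τ → ℕ} (h : ∑ u, α u = ∑ u, β u)
    (h' : ∑ u, α u • (u : M) = ∑ u, β u • (u : M)) :
    ∏ u : τ, X (⟨u, hτA u.2⟩ : A) ^ α u - ∏ u : τ, X (⟨u, hτA u.2⟩ : A) ^ β u ∈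
      toricIdeal K A τ := by
  classical
  have key : ∀ α : τ → ℕ, aeval (R := K) (fun u : A => if (u : M) ∈ τ then
      (AddMonoidAlgebra.single ((u : M), (1 : ℤ)) 1 : AddMonoidAlgebra K (M × ℤ)) else 0)
      (∏ u : τ, X (⟨u, hτA u.2⟩ : A) ^ α u) =
      AddMonoidAlgebra.of K (M × ℤ)
        (Multiplicative.ofAdd (∑ u, α u • (u : M), ((∑ u, α u : ℕ) : ℤ))) := by
    intro α
    have hsum : ((∑ u, α u • (u : M), ((∑ u, α u : ℕ) : ℤ)) : M × ℤ) =
        ∑ u : τ, α u • ((u : M), (1 : ℤ)) := by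
      ext <;> simp [Prod.fst_sum, Prod.snd_sum]
    rw [hsum, ofAdd_sum, map_prod, map_prod]
    refine Finset.prod_congr rfl fun u _ => ?_
    rw [map_pow, aeval_X, if_pos u.2, ofAdd_nsmul, map_pow]
    rfl
  rw [toricIdeal, RingHom.mem_ker, map_sub, sub_eq_zero]
  convert (key α).trans ?_
  rw [h, h']
  convert (key β).symm

theorem coord_ne_zero_of_mem_denseOrbit {v : A → K} (hv : v ≠ 0)
    (h : Projectivization.mk K v hv ∈ denseOrbit K A τ) {u : A} (hu : (u : M) ∈ τ) : v u ≠ 0 := by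
  obtain ⟨t, h1, x, rfl, w, hx⟩ := h
  rw [rescale_mk _ _ (units_mul_ne_zero _ h1), Projectivization.mk_eq_mk_iff'] at hx
  obtain ⟨a, rfl⟩ := hx
  have ha : a ≠ 0 := by
    rintro rfl
    exact hv (zero_smul K _)
  simp [hu, ha]

end ToricIdeal

/-! ### Cayley parametrizations attached to points of the line. -/

section CayleyForm

variable {K : Type*} [Field K] {M : Type*} {A τ : Finset M} {ℓ d : ℕ}

theorem cayleyForm_of_mem (π : τ → Simplex ℓ d) (f : Fin (ℓ + 1) → MvPolynomial (Fin 2) K)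
    (u : A) (h : (u : M) ∈ τ) : cayleyForm A π f u = ∏ i, f i ^ (π ⟨u, h⟩).1 i := dif_pos h

theorem cayleyForm_of_notMem (π : τ → Simplex ℓ d) (f : Fin (ℓ + 1) → MvPolynomial (Fin 2) K)
    (u : A) (h : (u : M) ∉ τ) : cayleyForm A π f u = 0 := dif_neg h

theorem cayleyForm_apply (hτA : τ ⊆ A) (π : τ → Simplex ℓ d)
    (f : Fin (ℓ + 1) → MvPolynomial (Fin 2) K) (u : τ) :
    cayleyForm A π f ⟨u, hτA u.2⟩ = ∏ i, f i ^ (π u).1 i := dif_pos u.2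

theorem isHomogeneous_cayleyForm (π : τ → Simplex ℓ d) {f : Fin (ℓ + 1) → MvPolynomial (Fin 2) K}
    (hf : ∀ i, (f i).IsHomogeneous 1) (u : A) : (cayleyForm A π f u).IsHomogeneous d := by
  by_cases h : (u : M) ∈ τ
  · rw [cayleyForm_of_mem π f u h]
    have := IsHomogeneous.prod Finset.univ (fun i => f i ^ (π ⟨u, h⟩).1 i)
      (fun i => 1 * (π ⟨u, h⟩).1 i) fun i _ => (hf i).pow _
    simpa only [one_mul, (π ⟨u, h⟩).2] using this
  · rw [cayleyForm_of_notMem π f u h]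
    exact isHomogeneous_zero _ _ _

/-- The forms `f i` are the equations of the points `P i`, up to scalars. -/
def AreFormsOf {ι : Type*} (f : ι → MvPolynomial (Fin 2) K) (P : ι → Line K) : Prop :=
  ∀ i, ∃ k : K, k ≠ 0 ∧ f i = C k * lineForm (P i)

theorem AreFormsOf.isHomogeneous {ι : Type*} {f : ι → MvPolynomial (Fin 2) K} {P : ι → Line K}
    (h : AreFormsOf f P) (i : ι) : (f i).IsHomogeneous 1 := by
  obtain ⟨k, -, hk⟩ := h i
  rw [hk]
  exact (isHomogeneous_lineForm _).C_mul k

theorem AreFormsOf.ne_zero {ι : Type*} {f : ι → MvPolynomial (Fin 2) K} {P : ι → Line K}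
    (h : AreFormsOf f P) (i : ι) : f i ≠ 0 := by
  obtain ⟨k, hk0, hk⟩ := h i
  rw [hk]
  exact mul_ne_zero (by simpa using hk0) (lineForm_ne_zero _)

theorem AreFormsOf.eval_eq_zero_iff {ι : Type*} {f : ι → MvPolynomial (Fin 2) K} {P : ι → Line K}
    (h : AreFormsOf f P) (i : ι) {y : Fin 2 → K} (hy : y ≠ 0) :
    eval y (f i) = 0 ↔ Projectivization.mk K y hy = P i := by
  obtain ⟨k, hk0, hk⟩ := h i
  rw [hk, map_mul, eval_C, mul_eq_zero, or_iff_right hk0, eval_lineForm_eq_zero_iff]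

theorem cayleyForm_ne_zero (π : τ → Simplex ℓ d) {f : Fin (ℓ + 1) → MvPolynomial (Fin 2) K}
    {P : Fin (ℓ + 1) → Line K} (hf : AreFormsOf f P) (u : A) (h : (u : M) ∈ τ) :
    cayleyForm A π f u ≠ 0 := by
  rw [cayleyForm_of_mem π f u h]
  exact Finset.prod_ne_zero_iff.2 fun i _ => pow_ne_zero _ (hf.ne_zero i)

theorem cayleyCurve_eq [IsAlgClosed K] (hd : d ≠ 0) (hτA : τ ⊆ A) (w : τ) (π : τ → Simplex ℓ d)
    {f : Fin (ℓ + 1) → MvPolynomial (Fin 2) K} {P : Fin (ℓ + 1) → Line K} (hf : AreFormsOf f P) :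
    cayleyCurve A π f = projZeros (paramIdeal (cayleyForm A π f)) := by
  rw [← projIdeal_paramImage hd (isHomogeneous_cayleyForm π hf.isHomogeneous)
    ⟨⟨w, hτA w.2⟩, cayleyForm_ne_zero π hf _ w.2⟩]
  rfl

end CayleyForm

/-! ### Properties of Cayley parametrizations and their comparison. -/

section Cayley

variable {K : Type*} [Field K] {M : Type*} [AddCommGroup M] {A τ : Finset M} {ℓ ℓ' d : ℕ}

/-- At most one `f i` vanishes at a given point because the `P i` are distinct, and
basepoint-freeness provides a `u` whose form does not contain that factor. -/
theorem hasNoCommonZero_cayleyForm (hτA : τ ⊆ A) {π : τ → Simplex ℓ d} (hπ : IsCayleyStructure π)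
    {f : Fin (ℓ + 1) → MvPolynomial (Fin 2) K} {P : Fin (ℓ + 1) → Line K}
    (hP : Function.Injective P) (hf : AreFormsOf f P) : HasNoCommonZero (cayleyForm A π f) := by
  intro y hy
  obtain ⟨u, hu⟩ : ∃ u : τ, ∀ i, eval y (f i) = 0 → (π u).1 i = 0 := by
    by_cases h : ∃ i, eval y (f i) = 0
    · obtain ⟨i, hi⟩ := h
      obtain ⟨u, hu⟩ := hπ.basepointFree i
      refine ⟨u, fun j hj => ?_⟩
      rw [hf.eval_eq_zero_iff _ hy] at hi hj
      rwa [hP (hj.symm.trans hi)]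
    · obtain ⟨u, -⟩ := hπ.nonconstant
      exact ⟨u, fun i hi => absurd ⟨i, hi⟩ h⟩
  refine ⟨⟨u, hτA u.2⟩, ?_⟩
  rw [cayleyForm_apply hτA, map_prod]
  refine Finset.prod_ne_zero_iff.2 fun i _ => ?_
  rw [map_pow]
  by_cases hi : eval y (f i) = 0
  · simp [hu i hi]
  · exact pow_ne_zero _ hi

/-- The `i`-th form is nonzero, linear and vanishes at the `i`-th point of the chosen normalized
representative. -/
theorem MarkedLine.exists_areFormsOf (p : MarkedLine K ℓ) :
    ∃ P : Fin (ℓ + 1) ↪ Line K, MarkedLine.mk P = p ∧ AreFormsOf p.forms P := by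
  obtain ⟨P, hP, h0, h1, -⟩ := p.exists_normalized.choose_spec
  refine ⟨P, hP, fun i => ?_⟩
  have hhom : (p.forms i).IsHomogeneous 1 := by
    rw [MarkedLine.forms]
    split_ifs
    · exact isHomogeneous_X _ _
    · exact (isHomogeneous_X _ _).sub (isHomogeneous_C_mul_X _ _)
  have hne : p.forms i ≠ 0 := by
    rw [MarkedLine.forms]
    split_ifs
    · exact X_ne_zero _
    · intro h
      have := congrArg (eval ![1, 0]) h
      simp at this
  have hdvd : lineForm (P i) ∣ p.forms i := by
    by_cases hi : i = 0
    · rw [hi, h0, infinitePoint, MarkedLine.forms, if_pos rfl,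
        lineForm_mk_dvd_iff (isHomogeneous_X _ _)]
      simp
    · rw [MarkedLine.forms, if_neg hi] at hhom ⊢
      rw [h1 i hi, affinePoint, lineForm_mk_dvd_iff hhom]
      simp [MarkedLine.coord]
  obtain ⟨r, hr, h⟩ := IsHomogeneous.exists_eq_mul (b := 0) (isHomogeneous_lineForm _) hhom hdvd
  obtain ⟨k, hk, rfl⟩ := IsHomogeneous.exists_eq_C_ne_zero hr (by
    rintro rfl
    exact hne (h.trans (mul_zero _)))
  exact ⟨k, hk, h.trans (mul_comm _ _)⟩

/-- Proportional Cayley parametrizations, up to an automorphism of the line, have the same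
exponents and the same marked points, up to a relabelling. -/
theorem exists_equiv_of_eq_substitute [Infinite K] (hτA : τ ⊆ A) {π : τ → Simplex ℓ d}
    {π' : τ → Simplex ℓ' d} (hπ : IsCayleyStructure π) (hπ' : IsCayleyStructure π')
    {f : Fin (ℓ + 1) → MvPolynomial (Fin 2) K} {f' : Fin (ℓ' + 1) → MvPolynomial (Fin 2) K}
    {P : Fin (ℓ + 1) → Line K} {P' : Fin (ℓ' + 1) → Line K} (hP : Function.Injective P)
    (hP' : Function.Injective P') (hf : AreFormsOf f P) (hf' : AreFormsOf f' P') {c c' : A → Kˣ}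
    {g : (Fin 2 → K) ≃ₗ[K] (Fin 2 → K)} {k : K} (hk : k ≠ 0)
    (h : ∀ u, C (c' u : K) * cayleyForm A π' f' u =
      C k * substitute g (C (c u : K) * cayleyForm A π f u)) :
    ∃ s : Fin (ℓ + 1) ≃ Fin (ℓ' + 1), (∀ (u : τ) i, (π' u).1 (s i) = (π u).1 i) ∧
      ∀ i, P i = g • P' (s i) := by
  have hmult : ∀ (Q : Line K) (u : τ),
      emultiplicity (lineForm Q) (C (c' ⟨u, hτA u.2⟩ : K) * ∏ i, f' i ^ (π' u).1 i) =
      emultiplicity (lineForm (g • Q)) (C (c ⟨u, hτA u.2⟩ : K) * ∏ i, f i ^ (π u).1 i) := by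
    intro Q u
    have hu := h ⟨u, hτA u.2⟩
    rw [cayleyForm_apply hτA, cayleyForm_apply hτA] at hu
    rw [hu, emultiplicity_mul (prime_lineForm Q), emultiplicity_lineForm_C Q hk, zero_add,
      emultiplicity_substitute]
  -- Conciseness makes `P i` a zero of one of the forms, so its preimage under `g` is a zero of the
  -- corresponding form on the other side.
  have h1 : ∀ i, ∃ j, P i = g • P' j := by
    intro i
    obtain ⟨u, hu⟩ := hπ.concise i
    obtain ⟨j, hj⟩ := exists_of_emultiplicity_lineForm_prod_ne_zero (Q := g⁻¹ • P i) hf'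
      (c' ⟨u, hτA u.2⟩).ne_zero (π' u).1 (by
        rw [hmult, smul_inv_smul, emultiplicity_lineForm_prod_self hP hf (Units.ne_zero _)]
        exact_mod_cast hu)
    exact ⟨j, by rw [hj, smul_inv_smul]⟩
  have h2 : ∀ j, ∃ i, P i = g • P' j := by
    intro j
    obtain ⟨u, hu⟩ := hπ'.concise j
    exact exists_of_emultiplicity_lineForm_prod_ne_zero (Q := g • P' j) hf
      (c ⟨u, hτA u.2⟩).ne_zero (π u).1 (by
        rw [← hmult, emultiplicity_lineForm_prod_self hP' hf' (Units.ne_zero _)]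
        exact_mod_cast hu)
  choose s hs using h1
  have hbij : Function.Bijective s := by
    refine ⟨fun i j hij => hP ?_, fun j => ?_⟩
    · rw [hs i, hs j, hij]
    · obtain ⟨i, hi⟩ := h2 j
      exact ⟨i, hP' (MulAction.injective g ((hs i).symm.trans hi))⟩
  refine ⟨Equiv.ofBijective s hbij, fun u i => ?_, hs⟩
  have h3 := hmult (P' (s i)) u
  rw [← hs i, emultiplicity_lineForm_prod_self hP hf (Units.ne_zero _),
    emultiplicity_lineForm_prod_self hP' hf' (Units.ne_zero _)] at h3
  exact_mod_cast h3

end Cayley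

/-! ### Parametrizations of a rational curve by forms of its degree. -/

section RationalCurve

variable {K : Type*} [Field K] {σ : Type*}

theorem IsOneDimensionalOfDegree.ne_zero {Z : Set (ℙ K (σ → K))} {d : ℕ}
    (h : IsOneDimensionalOfDegree Z d) : d ≠ 0 := by
  rintro rfl
  obtain ⟨P, -, h1, h2⟩ := h
  rw [Nat.cast_zero, Polynomial.leadingCoeff_eq_zero] at h2
  simp [h2] at h1

theorem IsRationalCurve.exists_param [IsAlgClosed K] [Fintype σ] {Z : Set (ℙ K (σ → K))} {d : ℕ}
    (h : IsRationalCurve Z d) :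
    ∃ (m : ℕ) (g : MvPolynomial (Fin 2) K) (ψ : σ → MvPolynomial (Fin 2) K) (b : ℕ)
      (G : Fin 2 → MvPolynomial σ K) (q : MvPolynomial σ K),
      g.IsHomogeneous m ∧ (∀ u, (ψ u).IsHomogeneous d) ∧ HasNoCommonZero ψ ∧
      projIdeal Z = paramIdeal ψ ∧ IsRationalInverse (paramIdeal ψ) g ψ b G q := by
  obtain ⟨m, e, g, ψ, b, G, q, -, hg, -, hψ, hψ0, hI, hinv⟩ :=
    exists_hasNoCommonZero_of_isBirationalToLine h.isProjVariety.2 h.isBirationalToLine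
  obtain rfl := degree_eq_of_isRationalInverse hI hψ hψ0 hinv h.isOneDimensionalOfDegree
  exact ⟨m, g, ψ, b, G, q, hg, hψ, hψ0, hI, hinv⟩

/-- Both families are compared with one birational parametrization; contravariance of pullback gives
the order in `γ⁻¹ * γ'`. -/
theorem IsRationalCurve.exists_eq_C_mul_substitute [IsAlgClosed K] [Fintype σ]
    {Z : Set (ℙ K (σ → K))} {d : ℕ} (h : IsRationalCurve Z d) {φ φ' : σ → MvPolynomial (Fin 2) K}
    (hφ : ∀ u, (φ u).IsHomogeneous d) (hφ0 : HasNoCommonZero φ) (hI : projIdeal Z = paramIdeal φ)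
    (hφ' : ∀ u, (φ' u).IsHomogeneous d) (hφ0' : HasNoCommonZero φ')
    (hI' : projIdeal Z = paramIdeal φ') :
    ∃ (g : (Fin 2 → K) ≃ₗ[K] (Fin 2 → K)) (c : K), c ≠ 0 ∧
      ∀ u, φ' u = C c * substitute g (φ u) := by
  obtain ⟨m, g, ψ, b, G, q, hg, hψ, hψ0, hIψ, hinv⟩ := h.exists_param
  have hd := h.isOneDimensionalOfDegree.ne_zero
  obtain ⟨γ, c, hc, hγ⟩ := ToricCurves.exists_eq_C_mul_substitute hd hg hψ hψ0 hinv hφ hφ0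
    (hI.symm.trans hIψ)
  obtain ⟨γ', c', hc', hγ'⟩ := ToricCurves.exists_eq_C_mul_substitute hd hg hψ hψ0 hinv hφ' hφ0'
    (hI'.symm.trans hIψ)
  refine ⟨γ⁻¹ * γ', c' * c⁻¹, mul_ne_zero hc' (inv_ne_zero hc), fun u => ?_⟩
  have hC : substitute (γ⁻¹ * γ') (C c) = C c := AlgHom.commutes _ c
  rw [hγ', hγ, C_mul, map_mul (substitute _), hC, substitute_substitute, mul_inv_cancel_left, ← C_mul, ← mul_assoc, ← C_mul,
    inv_mul_cancel_right₀ hc]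

end RationalCurve

/-! ### Automorphisms of the line with prescribed values at three points. -/

section Rigidity

variable {K : Type*} [Field K]

theorem exists_smul_of_smul_eq {g h : (Fin 2 → K) ≃ₗ[K] (Fin 2 → K)} {P : Line K}
    (hP : g • P = h • P) : ∃ c : K, c ≠ 0 ∧ g P.rep = c • h P.rep := by
  rw [← P.mk_rep, Projectivization.smul_mk, Projectivization.smul_mk,
    Projectivization.mk_eq_mk_iff'] at hP
  obtain ⟨c, hc⟩ := hP
  refine ⟨c, ?_, hc.symm⟩
  rintro rfl
  rw [zero_smul] at hc
  exact P.rep_nonzero (g.map_eq_zero_iff.1 hc.symm)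

/-- Linear automorphisms of the plane that agree on three points of the line are proportional. -/
theorem exists_eq_smul_of_three {g h : (Fin 2 → K) ≃ₗ[K] (Fin 2 → K)} {P Q R : Line K}
    (hPQ : P ≠ Q) (hRP : R ≠ P) (hRQ : R ≠ Q) (hP : g • P = h • P) (hQ : g • Q = h • Q)
    (hR : g • R = h • R) : ∃ c : K, c ≠ 0 ∧ ∀ y, g y = c • h y := by
  obtain ⟨p, hp, hgp⟩ := exists_smul_of_smul_eq hP
  obtain ⟨q, hq, hgq⟩ := exists_smul_of_smul_eq hQ
  obtain ⟨r, hr, hgr⟩ := exists_smul_of_smul_eq hR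
  have hli : LinearIndependent K ![P.rep, Q.rep] := Projectivization.linearIndependent_pair_iff_ne.2 hPQ
  have hspan : ∀ y : Fin 2 → K, ∃ a b : K, a • P.rep + b • Q.rep = y := by
    intro y
    have := hli.span_eq_top_of_card_eq_finrank' (by simp)
    rw [← Submodule.mem_span_pair, ← Matrix.range_cons_cons_empty, this]
    exact Submodule.mem_top
  obtain ⟨a, b, hab⟩ := hspan R.rep
  have hne : ∀ {S : Line K} {x : K}, x • S.rep = R.rep → R = S := by
    intro S x hx
    rw [← R.mk_rep, ← S.mk_rep, Projectivization.mk_eq_mk_iff']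
    exact ⟨x, hx⟩
  have ha : a ≠ 0 := by
    rintro rfl
    exact hRQ (hne (by simpa using hab))
  have hb : b ≠ 0 := by
    rintro rfl
    exact hRP (hne (by simpa using hab))
  -- Computing `g R.rep` both as `r • h R.rep` and through `R.rep = a • P.rep + b • Q.rep`. As `a`
  -- and `b` are nonzero, the three factors `p`, `q`, `r` agree.
  have hker : h ((a * (p - r)) • P.rep + (b * (q - r)) • Q.rep) = 0 := by
    have h1 := hgr
    rw [← hab, map_add, map_add, map_smul, map_smul, hgp, hgq, map_smul, map_smul] at h1
    rw [map_add, map_smul, map_smul, ← sub_eq_zero.2 h1]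
    module
  obtain ⟨h1, h2⟩ := LinearIndependent.pair_iff.1 hli _ _ (h.map_eq_zero_iff.1 hker)
  have hpr : p = r := sub_eq_zero.1 ((mul_eq_zero.1 h1).resolve_left ha)
  have hqr : q = r := sub_eq_zero.1 ((mul_eq_zero.1 h2).resolve_left hb)
  refine ⟨r, hr, fun y => ?_⟩
  obtain ⟨a, b, rfl⟩ := hspan y
  rw [map_add, map_add, map_smul, map_smul, hgp, hgq, hpr, hqr, map_smul, map_smul]
  module

end Rigidity

/-! ### Marked points and exponents from factorization. -/

section Existence

variable {K : Type*} [Field K] [IsAlgClosed K] {M : Type*} {A τ : Finset M} {d : ℕ}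

/-- The marked points are the zeros of all forms `ψ u` with `u ∈ τ`, each listed once, and `π u`
counts their multiplicities in `ψ u`. Conciseness holds by construction. -/
theorem exists_marking_eq_prod (hτA : τ ⊆ A) (w : τ) (hd : d ≠ 0) {ψ : A → MvPolynomial (Fin 2) K}
    (hψ : ∀ u, (ψ u).IsHomogeneous d) (hne : ∀ u : A, (u : M) ∈ τ → ψ u ≠ 0) :
    ∃ (ℓ : ℕ) (Q : Fin (ℓ + 1) ↪ Line K) (π : τ → Simplex ℓ d) (c : τ → K),
      (∀ u, c u ≠ 0) ∧ (∀ i, ∃ u, (π u).1 i ≠ 0) ∧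
      ∀ u : τ, ψ ⟨u, hτA u.2⟩ = C (c u) * ∏ i, lineForm (Q i) ^ (π u).1 i := by
  classical
  choose c s hc hs using fun u : τ =>
    exists_eq_prod_lineForm (hψ ⟨u, hτA u.2⟩) (hne ⟨u, hτA u.2⟩ u.2)
  let S : Finset (Line K) := Finset.univ.biUnion fun u => (s u).toFinset
  -- A label set `Fin (ℓ + 1)` requires at least one zero: without zeros `ψ w` would be constant,
  -- against `d ≠ 0`.
  have hcard : S.card ≠ 0 := by
    rw [Finset.card_ne_zero]
    by_contra hS
    rw [Finset.not_nonempty_iff_eq_empty] at hS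
    have hsw : (s w).toFinset ⊆ S :=
      Finset.subset_biUnion_of_mem (fun u => (s u).toFinset) (Finset.mem_univ w)
    rw [hS, Finset.subset_empty] at hsw
    have hw := hs w
    rw [Multiset.toFinset_eq_empty.1 hsw, Multiset.map_zero,
      Multiset.prod_zero, mul_one] at hw
    have h1 := hψ ⟨w, hτA w.2⟩
    have h2 := hne ⟨w, hτA w.2⟩ w.2
    rw [hw] at h1 h2
    exact hd (h1.inj_right (isHomogeneous_C _ _) h2)
  obtain ⟨ℓ, hℓ⟩ := Nat.exists_eq_succ_of_ne_zero hcard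
  let e : S ≃ Fin (ℓ + 1) := S.equivFinOfCardEq hℓ
  let Q : Fin (ℓ + 1) ↪ Line K := e.symm.toEmbedding.trans (Function.Embedding.subtype _)
  have hprod : ∀ u : τ, ψ ⟨u, hτA u.2⟩ = C (c u) * ∏ i, lineForm (Q i) ^ (s u).count (Q i) := by
    intro u
    rw [hs u, Finset.prod_multiset_map_count]
    congr 1
    rw [Finset.prod_subset (s₂ := S)
      (fun x hx => Finset.mem_biUnion.2 ⟨u, Finset.mem_univ u, hx⟩) fun x _ hx => by
        rw [Multiset.count_eq_zero.2 fun h => hx (Multiset.mem_toFinset.2 h), pow_zero],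
      ← Finset.prod_coe_sort, ← e.symm.prod_comp]
    rfl
  have hsum : ∀ u : τ, ∑ i, (s u).count (Q i) = d := by
    intro u
    have h1 : (∏ i, lineForm (Q i) ^ (s u).count (Q i)).IsHomogeneous
        (∑ i, 1 * (s u).count (Q i)) :=
      IsHomogeneous.prod _ _ _ fun i _ => (isHomogeneous_lineForm _).pow _
    have h2 := h1.C_mul (c u)
    rw [← hprod u] at h2
    simpa using h2.inj_right (hψ _) (hne _ u.2)
  refine ⟨ℓ, Q, fun u => ⟨fun i => (s u).count (Q i), hsum u⟩, c, hc, fun i => ?_, hprod⟩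
  obtain ⟨u, -, hu⟩ := Finset.mem_biUnion.1 (e.symm i).2
  exact ⟨u, Multiset.count_ne_zero.2 (Multiset.mem_toFinset.1 hu)⟩

/-- The automorphism `g` carries normalized points to the zeros, and the scalars between linear
forms are absorbed into `c`. Basepoint-freeness at `i` holds because some `ψ u` does not vanish at
the `i`-th zero, necessarily with `u ∈ τ`. -/
theorem exists_forms_eq_prod (hτA : τ ⊆ A) (w : τ) (hd : d ≠ 0) {ψ : A → MvPolynomial (Fin 2) K}
    (hψ : ∀ u, (ψ u).IsHomogeneous d) (hψ0 : HasNoCommonZero ψ)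
    (hne : ∀ u : A, (u : M) ∈ τ → ψ u ≠ 0) (hzero : ∀ u : A, (u : M) ∉ τ → ψ u = 0) :
    ∃ (ℓ : ℕ) (p : MarkedLine K ℓ) (π : τ → Simplex ℓ d) (c : τ → K)
      (g : (Fin 2 → K) ≃ₗ[K] (Fin 2 → K)), (∀ u, c u ≠ 0) ∧ (∀ i, ∃ u, (π u).1 i = 0) ∧
      (∀ i, ∃ u, (π u).1 i ≠ 0) ∧
      ∀ u : τ, substitute g (ψ ⟨u, hτA u.2⟩) = C (c u) * ∏ i, p.forms i ^ (π u).1 i := by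
  obtain ⟨ℓ, Q, π, c, hc, hconcise, hprod⟩ := exists_marking_eq_prod hτA w hd hψ hne
  obtain ⟨P, hP, hforms⟩ := (MarkedLine.mk Q).exists_areFormsOf
  obtain ⟨g, hg⟩ : ∃ g : (Fin 2 → K) ≃ₗ[K] (Fin 2 → K), g • P = Q := Quotient.exact hP.symm
  have hline : ∀ i, ∃ k : K, k ≠ 0 ∧
      substitute g (lineForm (Q i)) = C k * (MarkedLine.mk Q).forms i := by
    intro i
    obtain ⟨k, hk, hk'⟩ := hforms i
    obtain ⟨k', hk0, hk0'⟩ := substitute_lineForm g (P i)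
    have hQ : g • P i = Q i := by rw [← hg]; rfl
    refine ⟨k' * k⁻¹, mul_ne_zero hk0 (inv_ne_zero hk), ?_⟩
    rw [← hQ, hk0', hk', ← mul_assoc, ← C_mul, inv_mul_cancel_right₀ hk]
  choose k hk hline using hline
  refine ⟨ℓ, MarkedLine.mk Q, π, fun u => c u * ∏ i, k i ^ (π u).1 i, g, fun u => ?_, fun i => ?_,
    hconcise, fun u => ?_⟩
  · exact mul_ne_zero (hc u) (Finset.prod_ne_zero_iff.2 fun i _ => pow_ne_zero _ (hk i))
  · obtain ⟨u, hu⟩ := hψ0 (Q i).rep (Q i).rep_nonzero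
    have huτ : (u : M) ∈ τ := by
      by_contra huτ
      exact hu (by rw [hzero u huτ, map_zero])
    refine ⟨⟨u, huτ⟩, ?_⟩
    by_contra hi
    refine hu (eval_eq_zero_of_lineForm_dvd ?_)
    rw [show u = ⟨(⟨u, huτ⟩ : τ), hτA huτ⟩ from rfl, hprod]
    exact ((dvd_pow_self _ hi).trans (Finset.dvd_prod_of_mem
      (fun j => lineForm (Q j) ^ (π ⟨u, huτ⟩).1 j) (Finset.mem_univ i))).mul_left _
  · have hC : substitute g (C (c u)) = C (c u) := AlgHom.commutes _ _
    rw [hprod, map_mul, hC, map_prod, C_mul, map_prod, mul_assoc, ← Finset.prod_mul_distrib]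
    simp only [map_pow, hline, mul_pow]

end Existence

/-! ### From binomial equations to affine-linearity and a torus point. -/

section AffineRelations

variable {K : Type*} [Field K] {M : Type*} [AddCommGroup M] {A τ : Finset M} {ℓ d : ℕ}

/-- Forms that satisfy the binomial equations of the toric variety have affine-linear exponents,
and their coefficients come from a point of the torus. -/
theorem exists_torus_of_toricIdeal_le (hτA : τ ⊆ A) {φ : A → MvPolynomial (Fin 2) K}
    (hle : toricIdeal K A τ ≤ paramIdeal φ) {f : Fin (ℓ + 1) → MvPolynomial (Fin 2) K}
    {P : Fin (ℓ + 1) → Line K} (hP : Function.Injective P) (hf : AreFormsOf f P)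
    (π : τ → Simplex ℓ d) {c : τ → K} (hc : ∀ u, c u ≠ 0)
    (hφ : ∀ u : τ, φ ⟨u, hτA u.2⟩ = C (c u) * ∏ i, f i ^ (π u).1 i) :
    IsAffineLinear π ∧ ∃ t : Torus K τ, ∀ u w : τ,
      (t (Multiplicative.ofAdd (diff u w)) : K) = c u / c w := by
  have hpow : ∀ α : τ → ℕ, bind₁ φ (∏ u : τ, X (⟨u, hτA u.2⟩ : A) ^ α u) =
      C (∏ u, c u ^ α u) * ∏ i, f i ^ ∑ u, α u * (π u).1 i := by
    intro α
    simp only [map_prod, map_pow, bind₁_X_right, hφ, mul_pow, Finset.prod_mul_distrib]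
    congr 1
    simp only [← Finset.prod_pow, ← pow_mul]
    rw [Finset.prod_comm]
    refine Finset.prod_congr rfl fun i _ => ?_
    rw [Finset.prod_pow_eq_pow_sum]
    simp only [mul_comm]
  -- An affine relation in `τ` gives a binomial equation of the curve; unique factorization
  -- separates its coefficients from its exponents.
  have hrel : ∀ α β : τ → ℕ, ∑ u, α u = ∑ u, β u → ∑ u, α u • (u : M) = ∑ u, β u • (u : M) →
      ∏ u, c u ^ α u = ∏ u, c u ^ β u ∧
      (fun i => ∑ u, α u * (π u).1 i) = fun i => ∑ u, β u * (π u).1 i := by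
    intro α β h1 h2
    have h3 := hle (binomial_mem_toricIdeal (K := K) hτA h1 h2)
    rw [mem_paramIdeal, map_sub, sub_eq_zero, hpow, hpow] at h3
    exact eq_of_C_mul_prod_eq hP hf (Finset.prod_ne_zero_iff.2 fun u _ => pow_ne_zero _ (hc u))
      (Finset.prod_ne_zero_iff.2 fun u _ => pow_ne_zero _ (hc u)) h3
  constructor
  · obtain ⟨L, hL⟩ := exists_addMonoidHom_diffLattice
      (fun (u : τ) (i : Fin (ℓ + 1)) => ((π u).1 i : ℤ)) fun α β h1 h2 => by
        ext i
        have := congrFun (hrel α β h1 h2).2 i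
        simp only [Finset.sum_apply, Pi.smul_apply]
        simp only [nsmul_eq_mul]
        exact_mod_cast this
    exact ⟨L, fun u w i => by rw [hL]; rfl⟩
  · obtain ⟨L, hL⟩ := exists_addMonoidHom_diffLattice
      (fun u : τ => Additive.ofMul (Units.mk0 (c u) (hc u))) fun α β h1 h2 => by
        have := (hrel α β h1 h2).1
        simp only [← ofMul_pow, ← ofMul_prod]
        congr 1
        ext
        simpa using this
    refine ⟨AddMonoidHom.toMultiplicativeLeft L, fun u w => ?_⟩
    have h1 : AddMonoidHom.toMultiplicativeLeft L (Multiplicative.ofAdd (diff u w)) =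
      (L (diff u w)).toMul := rfl
    rw [h1, hL, ← ofMul_div, toMul_ofMul, Units.val_div_eq_div_val, Units.val_mk0, Units.val_mk0]

end AffineRelations

/-! ### Existence, uniqueness and finiteness of the stabilizer. -/

section Main

variable {K : Type*} [Field K] {M : Type*} [AddCommGroup M] {A τ : Finset M}
  {Z : Set (ℙ K (A → K))} {d : ℕ}

theorem IsFace.subset (h : IsFace τ A) : τ ⊆ A := by
  obtain ⟨F, -, -, hF⟩ := h
  exact fun u hu => ((hF u).1 hu).1

theorem nonempty_of_denseOrbit (hmeet : (Z ∩ denseOrbit K A τ).Nonempty) : Nonempty τ := by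
  obtain ⟨x, -, t, h, x', -, w, -⟩ := hmeet
  exact ⟨w⟩

theorem X_notMem_projIdeal (hmeet : (Z ∩ denseOrbit K A τ).Nonempty) {u : A} (hu : (u : M) ∈ τ) :
    X u ∉ projIdeal Z := by
  obtain ⟨x, hxC, hx⟩ := hmeet
  induction x using Projectivization.ind with
  | h v hv =>
    intro h
    have := mem_projIdeal.1 h v hv hxC
    rw [eval_X] at this
    exact coord_ne_zero_of_mem_denseOrbit hv hx hu this

theorem torusScalars_self (t : Torus K τ) (hτA : τ ⊆ A) (w : τ) :
    torusScalars A t w ⟨w, hτA w.2⟩ = 1 := by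
  rw [torusScalars_apply]
  have : diff w w = 0 := Subtype.ext (sub_self _)
  exact (congrArg (fun x => t (Multiplicative.ofAdd x)) this).trans (map_one t)

theorem HasNoCommonZero.units_mul {ι : Type*} {φ : ι → MvPolynomial (Fin 2) K}
    (h : HasNoCommonZero φ) (c : ι → Kˣ) : HasNoCommonZero fun u => C (c u : K) * φ u := by
  intro y hy
  obtain ⟨u, hu⟩ := h y hy
  exact ⟨u, by rw [map_mul, eval_C]; exact mul_ne_zero (c u).ne_zero hu⟩

variable [IsAlgClosed K]

theorem translate_cayleyCurve_eq (hd : d ≠ 0) (hτA : τ ⊆ A) (w : τ) {ℓ : ℕ} (π : τ → Simplex ℓ d)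
    {f : Fin (ℓ + 1) → MvPolynomial (Fin 2) K} {P : Fin (ℓ + 1) → Line K} (hf : AreFormsOf f P)
    (t : Torus K τ) : translate t (cayleyCurve A π f) =
      projZeros (paramIdeal fun u => C (torusScalars A t w u : K) * cayleyForm A π f u) := by
  rw [cayleyCurve_eq hd hτA w π hf, translate_projZeros hd
    (isHomogeneous_cayleyForm π hf.isHomogeneous) (fun u hu => cayleyForm_of_notMem π f u hu) t w]

theorem exists_cayley (hτA : τ ⊆ A) (hZ : IsRationalCurve Z d) (hZτ : Z ⊆ toricVariety K A τ)
    (hmeet : (Z ∩ denseOrbit K A τ).Nonempty) :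
    ∃ (ℓ : ℕ) (π : τ → Simplex ℓ d) (p : MarkedLine K ℓ) (t : Torus K τ),
      IsCayleyStructure π ∧ Z = translate t (cayleyCurve A π p.forms) := by
  have hd := hZ.isOneDimensionalOfDegree.ne_zero
  obtain ⟨w⟩ := nonempty_of_denseOrbit hmeet
  obtain ⟨-, -, ψ, -, -, -, -, hψ, hψ0, hI, -⟩ := hZ.exists_param
  have hle : toricIdeal K A τ ≤ projIdeal Z := le_projIdeal_of_subset_projZeros hZτ
  have hne : ∀ u : A, (u : M) ∈ τ → ψ u ≠ 0 := fun u hu h => by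
    refine X_notMem_projIdeal hmeet hu ?_
    rw [hI, mem_paramIdeal, bind₁_X_right, h]
  have hzero : ∀ u : A, (u : M) ∉ τ → ψ u = 0 := fun u hu => by
    have := hle (X_mem_toricIdeal hu)
    rwa [hI, mem_paramIdeal, bind₁_X_right] at this
  obtain ⟨ℓ, p, π, c, g, hc, hbpf, hconcise, hprod⟩ :=
    exists_forms_eq_prod hτA w hd hψ hψ0 hne hzero
  obtain ⟨P, -, hf⟩ := p.exists_areFormsOf
  have hIφ : projIdeal Z = paramIdeal fun u => substitute g (ψ u) := by
    rw [paramIdeal_substitute, hI]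
  obtain ⟨haff, t, ht⟩ := exists_torus_of_toricIdeal_le hτA (hle.trans_eq hIφ) P.injective hf π hc
    hprod
  refine ⟨ℓ, π, p, t, ⟨haff, ?_, hbpf, hconcise⟩, ?_⟩
  -- Nonconstancy is automatic: the coordinate with index `0` vanishes at one element of `τ` and not
  -- at another.
  · obtain ⟨u, hu⟩ := hbpf 0
    obtain ⟨v, hv⟩ := hconcise 0
    exact ⟨u, v, fun h => hv (h ▸ hu)⟩
  -- The torus point only yields the ratios `c u / c w`; the remaining common factor `c w` does not
  -- change the ideal.
  · rw [translate_cayleyCurve_eq hd hτA w π hf, ← paramIdeal_const_mul hd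
      (fun u => (isHomogeneous_cayleyForm π hf.isHomogeneous u).C_mul _) (hc w)]
    conv_lhs => rw [← hZ.isProjVariety.1, projClosure, hIφ]
    congr 2
    ext1 u
    by_cases hu : (u : M) ∈ τ
    · rw [cayleyForm_of_mem π _ u hu, torusScalars_of_mem t w u hu, ht, ← mul_assoc, ← C_mul,
        mul_div_cancel₀ _ (hc w)]
      exact hprod ⟨u, hu⟩
    · rw [hzero u hu, cayleyForm_of_notMem π _ u hu, mul_zero, mul_zero, map_zero]

/-- Two Cayley parametrizations of the same curve differ by an automorphism of the line. -/
theorem exists_substitute_of_projZeros_eq (hτA : τ ⊆ A) (hZ : IsRationalCurve Z d) {ℓ ℓ' : ℕ}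
    {π : τ → Simplex ℓ d} {π' : τ → Simplex ℓ' d} (hπ : IsCayleyStructure π)
    (hπ' : IsCayleyStructure π') {f : Fin (ℓ + 1) → MvPolynomial (Fin 2) K}
    {f' : Fin (ℓ' + 1) → MvPolynomial (Fin 2) K} {P : Fin (ℓ + 1) → Line K}
    {P' : Fin (ℓ' + 1) → Line K} (hP : Function.Injective P) (hP' : Function.Injective P')
    (hf : AreFormsOf f P) (hf' : AreFormsOf f' P') (c c' : A → Kˣ)
    (h : Z = projZeros (paramIdeal fun u => C (c u : K) * cayleyForm A π f u))
    (h' : Z = projZeros (paramIdeal fun u => C (c' u : K) * cayleyForm A π' f' u)) :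
    ∃ (g : (Fin 2 → K) ≃ₗ[K] (Fin 2 → K)) (k : K), k ≠ 0 ∧
      ∀ u, C (c' u : K) * cayleyForm A π' f' u =
        C k * substitute g (C (c u : K) * cayleyForm A π f u) := by
  have hd := hZ.isOneDimensionalOfDegree.ne_zero
  have hφ := fun u => (isHomogeneous_cayleyForm (A := A) π hf.isHomogeneous u).C_mul (c u : K)
  have hφ' := fun u => (isHomogeneous_cayleyForm (A := A) π' hf'.isHomogeneous u).C_mul (c' u : K)
  have hφ0 := (hasNoCommonZero_cayleyForm hτA hπ hP hf).units_mul c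
  have hφ0' := (hasNoCommonZero_cayleyForm hτA hπ' hP' hf').units_mul c'
  refine hZ.exists_eq_C_mul_substitute hφ hφ0 ?_ hφ' hφ0' ?_
  · rw [h, projIdeal_projZeros_paramIdeal hd hφ hφ0.exists_ne_zero]
  · rw [h', projIdeal_projZeros_paramIdeal hd hφ' hφ0'.exists_ne_zero]

theorem cayley_unique (hτA : τ ⊆ A) (hZ : IsRationalCurve Z d) {ℓ ℓ' : ℕ} {π : τ → Simplex ℓ d}
    {π' : τ → Simplex ℓ' d} {p : MarkedLine K ℓ} {p' : MarkedLine K ℓ'} {t t' : Torus K τ}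
    (hπ : IsCayleyStructure π) (h : Z = translate t (cayleyCurve A π p.forms))
    (hπ' : IsCayleyStructure π') (h' : Z = translate t' (cayleyCurve A π' p'.forms)) :
    ℓ = ℓ' ∧ ∃ s : Fin (ℓ + 1) ≃ Fin (ℓ' + 1),
      (∀ (u : τ) (i : Fin (ℓ + 1)), (π' u).1 (s i) = (π u).1 i) ∧ p' = p.relabel s := by
  have hd := hZ.isOneDimensionalOfDegree.ne_zero
  obtain ⟨w, -⟩ := hπ.nonconstant
  obtain ⟨P, hP, hf⟩ := p.exists_areFormsOf
  obtain ⟨P', hP', hf'⟩ := p'.exists_areFormsOf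
  rw [translate_cayleyCurve_eq hd hτA w π hf] at h
  rw [translate_cayleyCurve_eq hd hτA w π' hf'] at h'
  obtain ⟨g, k, hk, hg⟩ := exists_substitute_of_projZeros_eq hτA hZ hπ hπ' P.injective P'.injective
    hf hf' _ _ h h'
  obtain ⟨s, hs, hPs⟩ := exists_equiv_of_eq_substitute hτA hπ hπ' P.injective P'.injective hf hf'
    hk hg
  refine ⟨by simpa using Fintype.card_congr s, s, hs, ?_⟩
  rw [← hP, ← hP']
  refine Quotient.sound ⟨g⁻¹, ?_⟩
  ext1 j
  change g⁻¹ • P (s.symm j) = P' j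
  rw [hPs, inv_smul_smul, Equiv.apply_symm_apply]

/-- Proportional automorphisms have proportional pullbacks, so the scalars of `γ` and `γ'` differ by
a common factor. It is `1` because the weight of `w` is normalized to `0`. -/
theorem torus_eq_of_substitute (hτA : τ ⊆ A) (w : τ) {φ : A → MvPolynomial (Fin 2) K}
    (hφ : ∀ u, (φ u).IsHomogeneous d) (hne : ∀ u : A, (u : M) ∈ τ → φ u ≠ 0)
    {γ γ' : Torus K τ} {g g' : (Fin 2 → K) ≃ₗ[K] (Fin 2 → K)} {k k' : K} (hk' : k' ≠ 0)
    (h : ∀ u, C (torusScalars A γ w u : K) * φ u = C k * substitute g (φ u))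
    (h' : ∀ u, C (torusScalars A γ' w u : K) * φ u = C k' * substitute g' (φ u))
    {c : K} (hg : ∀ y, g y = c • g' y) : γ = γ' := by
  have hsub : ∀ u, substitute g (φ u) = C (c ^ d) * substitute g' (φ u) := fun u =>
    MvPolynomial.funext fun y => by
      rw [eval_substitute, hg, IsHomogeneous.eval_smul (hφ u), map_mul, eval_C, eval_substitute]
  have key : ∀ u : τ, (torusScalars A γ w ⟨u, hτA u.2⟩ : K) =
      k * c ^ d * k'⁻¹ * torusScalars A γ' w ⟨u, hτA u.2⟩ := by
    intro u
    apply C_injective (Fin 2)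
    apply mul_right_cancel₀ (hne ⟨u, hτA u.2⟩ u.2)
    rw [h, hsub, C_mul, mul_assoc (C _) (C _), h', ← mul_assoc, ← mul_assoc, ← C_mul, ← C_mul,
      inv_mul_cancel_right₀ hk']
  have h1 : k * c ^ d * k'⁻¹ = 1 := by
    have := key w
    rw [torusScalars_self, torusScalars_self, Units.val_one, mul_one] at this
    exact this.symm
  refine torus_ext w fun u => ?_
  have := key u
  rw [h1, one_mul, torusScalars_apply, torusScalars_apply] at this
  exact Units.ext this

/-- Applying the comparison of Cayley parametrizations to the curve and its translate attaches a
permutation of the marked points to each stabilizing element. Only injectivity of this choice is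
needed, not multiplicativity. -/
theorem finite_stabilizer (hτA : τ ⊆ A) (hZ : IsRationalCurve Z d) {ℓ : ℕ} {π : τ → Simplex ℓ d}
    {p : MarkedLine K ℓ} {t : Torus K τ} (hπ : IsCayleyStructure π)
    (h : Z = translate t (cayleyCurve A π p.forms)) (hℓ : 1 < ℓ) :
    {g : Torus K τ | translate g Z = Z}.Finite := by
  have hd := hZ.isOneDimensionalOfDegree.ne_zero
  obtain ⟨w, -⟩ := hπ.nonconstant
  obtain ⟨P, hP, hf⟩ := p.exists_areFormsOf
  rw [translate_cayleyCurve_eq hd hτA w π hf] at h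
  set φ : A → MvPolynomial (Fin 2) K :=
    fun u => C (torusScalars A t w u : K) * cayleyForm A π p.forms u with hφdef
  have hφ : ∀ u, (φ u).IsHomogeneous d := fun u =>
    (isHomogeneous_cayleyForm π hf.isHomogeneous u).C_mul _
  have hφ0 : ∀ u : A, (u : M) ∉ τ → φ u = 0 := fun u hu => by
    rw [hφdef]
    simp only [cayleyForm_of_notMem π _ u hu, mul_zero]
  have hφne : ∀ u : A, (u : M) ∈ τ → φ u ≠ 0 := fun u hu =>
    mul_ne_zero (by simp) (cayleyForm_ne_zero π hf u hu)
  have key : ∀ γ : {γ : Torus K τ | translate γ Z = Z}, ∃ (s : Equiv.Perm (Fin (ℓ + 1)))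
      (g : (Fin 2 → K) ≃ₗ[K] (Fin 2 → K)) (k : K), k ≠ 0 ∧ (∀ i, P i = g • P (s i)) ∧
      ∀ u, C (torusScalars A γ.1 w u : K) * φ u = C k * substitute g (φ u) := by
    rintro ⟨γ, hγ⟩
    have hγ' : translate γ Z = Z := hγ
    rw [h, translate_projZeros hd hφ hφ0 γ w, ← h] at hγ'
    -- The translate is again a rescaled Cayley parametrization with the same `π` and the same
    -- forms.
    have hmul : (fun u => C (torusScalars A γ w u : K) * φ u) = fun u =>
        C ((torusScalars A γ w u * torusScalars A t w u : Kˣ) : K) *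
          cayleyForm A π p.forms u := by
      ext1 u
      rw [Units.val_mul, C_mul, mul_assoc]
    rw [hmul] at hγ'
    obtain ⟨g, k, hk, hg⟩ := exists_substitute_of_projZeros_eq hτA hZ hπ hπ P.injective
      P.injective hf hf _ _ h hγ'.symm
    obtain ⟨s, -, hs⟩ := exists_equiv_of_eq_substitute hτA hπ hπ P.injective P.injective hf hf hk hg
    exact ⟨s, g, k, hk, hs, fun u => (congrFun hmul u).trans (hg u)⟩
  choose s g k hk hs hg using key
  suffices hs : Function.Injective s from Set.finite_coe_iff.1 (Finite.of_injective s hs)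
  intro γ γ' hγ
  have hfix : ∀ i, g γ • P (s γ i) = g γ' • P (s γ i) := fun i => by
    rw [← hs γ, hγ, ← hs γ']
  have hfix' : ∀ j, g γ • P j = g γ' • P j := fun j => by
    simpa using hfix ((s γ).symm j)
  -- The hypothesis `1 < ℓ` supplies the three distinct points.
  obtain ⟨c, -, hc⟩ := exists_eq_smul_of_three
    (P.injective.ne (show (⟨0, by omega⟩ : Fin (ℓ + 1)) ≠ ⟨1, by omega⟩ by simp))
    (P.injective.ne (show (⟨2, by omega⟩ : Fin (ℓ + 1)) ≠ ⟨0, by omega⟩ by simp))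
    (P.injective.ne (show (⟨2, by omega⟩ : Fin (ℓ + 1)) ≠ ⟨1, by omega⟩ by simp))
    (hfix' _) (hfix' _) (hfix' _)
  exact Subtype.ext (torus_eq_of_substitute hτA w hφ hφne (hk γ') (hg γ) (hg γ') hc)

end Main

end ToricCurves

end

open ToricCurves in
theorem mainTheorem8 {K : Type*} [Field K] [IsAlgClosed K] [CharZero K]
    {M : Type*} [AddCommGroup M] [Module.Free ℤ M] [Module.Finite ℤ M]
    (A τ : Finset M) (hτ : IsFace τ A)
    (C : Set (ℙ K (A → K))) (d : ℕ) (hC : IsRationalCurve C d)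
    (hCτ : C ⊆ toricVariety K A τ) (hmeet : (C ∩ denseOrbit K A τ).Nonempty) :
    -- existence
    (∃ (ℓ : ℕ) (π : τ → Simplex ℓ d) (p : MarkedLine K ℓ) (t : Torus K τ),
      IsCayleyStructure π ∧ C = translate t (cayleyCurve A π p.forms)) ∧
    -- uniqueness up to a permutation
    (∀ (ℓ ℓ' : ℕ) (π : τ → Simplex ℓ d) (π' : τ → Simplex ℓ' d)
      (p : MarkedLine K ℓ) (p' : MarkedLine K ℓ') (t t' : Torus K τ),
      IsCayleyStructure π → C = translate t (cayleyCurve A π p.forms) →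
      IsCayleyStructure π' → C = translate t' (cayleyCurve A π' p'.forms) →
      ℓ = ℓ' ∧ ∃ s : Fin (ℓ + 1) ≃ Fin (ℓ' + 1),
        (∀ (u : τ) (i : Fin (ℓ + 1)), (π' u).1 (s i) = (π u).1 i) ∧ p' = p.relabel s) ∧
    -- finiteness of the stabilizer
    (∀ (ℓ : ℕ) (π : τ → Simplex ℓ d) (p : MarkedLine K ℓ) (t : Torus K τ),
      IsCayleyStructure π → C = translate t (cayleyCurve A π p.forms) → 1 < ℓ →
      {g : Torus K τ | translate g C = C}.Finite) := by
  have hτA := hτ.subset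
  exact ⟨exists_cayley hτA hC hCτ hmeet,
    fun _ _ _ _ _ _ _ _ hπ h hπ' h' => cayley_unique hτA hC hπ h hπ' h',
    fun _ _ _ _ hπ h hℓ => finite_stabilizer hτA hC hπ h hℓ⟩
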